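/- Let $\omega_1,\omega_2,g\in\mathbb C$ satisfy $\operatorname{Re}\omega_1>0$, $\operatorname{Re}\omega_2>0$, $0<\operatorname{Re}g<\operatorname{Re}\omega_1+\operatorname{Re}\omega_2$ and $\nu_g:=\operatorname{Re}\frac{g}{\omega_1\omega_2}>0$. Let $S_2(z)=S_2(z|\omega_1,\omega_2)$ be the double sine function: the meromorphic function given for $0<\operatorname{Re}z<\operatorname{Re}(\omega_1+\omega_2)$ by $$S_2(z)=\exp\int_0^\infty\frac{dt}{2t}\left(\frac{\sinh[(2z-\omega_1-\omega_2)t]}{\sinh(\omega_1t)\sinh(\omega_2t)}-\frac{2z-\omega_1-\omega_2}{\omega_1\omega_2t}\right)$$ and continued to $\mathbb C$ by $S_2(z)=2\sin\frac{\pi z}{\omega_2}\,S_2(z+\omega_1)$. Put $g^*=\omega_1+\omega_2-g$, $$\mu(x)=\frac{S_2(ix)}{S_2(ix+g)},\qquad K(x)=\frac{1}{S_2(ix+g^*/2)\,S_2(-ix+g^*/2)},\qquad d_m=\frac1{m!}\bigl[\sqrt{\omega_1\omega_2}\,S_2(g)\bigr]^{-m}$$ (principal square root). For $\lambda\in\mathbb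 C$ define the integral operators $$(Q_m(\lambda)f)(\mathbf x)=d_m\int_{\mathbb R^m}e^{2\pi i\lambda(\sum_i x_i-\sum_j y_j)}\prod_{i=1}^m\prod_{j=1}^mK(x_i-y_j)\prod_{i\ne j}\mu(y_i-y_j)\,f(\mathbf y)\,d\mathbf y,\qquad \mathbf x\in\mathbb R^m,$$ $$(\Lambda_m(\lambda)f)(\mathbf x)=d_{m-1}\int_{\mathbb R^{m-1}}e^{2\pi i\lambda(\sum_i x_i-\sum_j y_j)}\prod_{i=1}^m\prod_{j=1}^{m-1}K(x_i-y_j)\prod_{i\ne j}\mu(y_i-y_j)\,f(\mathbf y)\,d\mathbf y,\qquad \mathbf x\in\mathbb R^m .$$ Let $n\ge1$, $\varepsilon\in[0,1)$, and let $\lambda,\lambda_1,\dots,\lambda_n\in\mathbb C$ satisfy $$|\operatorname{Im}(\lambda-\lambda_n)|<\frac{\nu_g}{2}(1-\varepsilon),\qquad |\operatorname{Im}(\lambda_k-\lambda_j)|<\frac{\nu_g}{4\,(n-1)!\,e}\,\varepsilon\quad(k,j=1,\dots,n).$$ Then for every $\mathbf x\in\mathbb R^n$ the multiple integrals $$I_{\lambda,\boldsymbol\lambda_n}(\mathbf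 x)=Q_n(\lambda)\,\Lambda_n(\lambda_n)\,\Lambda_{n-1}(\lambda_{n-1})\cdots\Lambda_2(\lambda_2)\,e^{2\pi i\lambda_1x_1},$$ $$J_{\lambda,\boldsymbol\lambda_n}(\mathbf x)=\Lambda_n(\lambda_n)\,Q_{n-1}(\lambda)\,\Lambda_{n-1}(\lambda_{n-1})\cdots\Lambda_2(\lambda_2)\,e^{2\pi i\lambda_1x_1},$$ $$\Psi_{\boldsymbol\lambda_n}(\mathbf x)=\Lambda_n(\lambda_n)\,\Lambda_{n-1}(\lambda_{n-1})\cdots\Lambda_2(\lambda_2)\,e^{2\pi i\lambda_1x_1}$$ are absolutely convergent: the product of all kernels and of the final exponential is absolutely integrable over the space of all integration variables ($\mathbb R^{n(n+1)/2}$, $\mathbb R^{(n-1)(n+2)/2}$ and $\mathbb R^{n(n-1)/2}$, respectively), and its integral is the value of the iterated product of operators. (The exponential $e^{2\pi i\lambda_1x_1}$ is read as $\Lambda_1(\lambda_1)1$; thus for $n=1$ the expressions $J$ and $\Psi$ involve no integration, both being equal to $e^{2\pi i\lambda_1x_1}$.) -/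

import Mathlib

open MeasureTheory

namespace Ruijsenaars

noncomputable section

/-- The double sine function `S₂(z|ω₁,ω₂)` (for `Re ω₁, Re ω₂ > 0`) in its strip of regularity
`0 < Re z < Re (ω₁ + ω₂)`, where it has neither zeros nor poles: the exponential of the standard
integral representation of `ln S₂`. -/
def doubleSineStrip (ω₁ ω₂ z : ℂ) : ℂ :=
  Complex.exp (∫ t in Set.Ioi (0 : ℝ),
    (1 / (2 * (t : ℂ))) *
      (Complex.sinh ((2 * z - ω₁ - ω₂) * t) / (Complex.sinh (ω₁ * t) * Complex.sinh (ω₂ * t))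
        - (2 * z - ω₁ - ω₂) / (ω₁ * ω₂ * t)))

/-- Continuation of the double sine function to the half plane `Re z < Re (ω₁ + ω₂)` by the
functional relation `S₂(z) = 2 sin (π z / ω₂) S₂(z + ω₁)`. The number `m` of shifts is `0` for
`0 < Re z`, and for `Re z ≤ 0` it is the least `m` with `0 < Re (z + m ω₁)`. -/
def doubleSineLeft (ω₁ ω₂ z : ℂ) : ℂ :=
  (∏ j ∈ Finset.range ⌊1 - z.re / ω₁.re⌋₊,
      2 * Complex.sin (Real.pi * (z + j * ω₁) / ω₂))
    * doubleSineStrip ω₁ ω₂ (z + (⌊1 - z.re / ω₁.re⌋₊ : ℕ) * ω₁)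

/-- The double sine function `S₂(z|ω₁,ω₂)` on the whole plane, for `Re ω₁, Re ω₂ > 0`. In
`Re z ≥ Re (ω₁ + ω₂)` it is given by the inversion relation `S₂(z) S₂(ω₁ + ω₂ - z) = 1`
(at its poles the value is `0`, by the convention for division). -/
def doubleSine (ω₁ ω₂ z : ℂ) : ℂ :=
  if z.re < (ω₁ + ω₂).re then doubleSineLeft ω₁ ω₂ z
  else (doubleSineLeft ω₁ ω₂ (ω₁ + ω₂ - z))⁻¹

/-- `ν_g = Re (g / (ω₁ ω₂))`. -/
def nu (ω₁ ω₂ g : ℂ) : ℝ := (g / (ω₁ * ω₂)).re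

/-- `μ(x) = S₂(i x) / S₂(i x + g)`. -/
def mu (ω₁ ω₂ g x : ℂ) : ℂ :=
  doubleSine ω₁ ω₂ (Complex.I * x) * (doubleSine ω₁ ω₂ (Complex.I * x + g))⁻¹

/-- `K(x) = S₂(i x + g* / 2)⁻¹ S₂(- i x + g* / 2)⁻¹` with `g* = ω₁ + ω₂ - g`. -/
def kerK (ω₁ ω₂ g x : ℂ) : ℂ :=
  (doubleSine ω₁ ω₂ (Complex.I * x + (ω₁ + ω₂ - g) / 2))⁻¹
    * (doubleSine ω₁ ω₂ (-(Complex.I * x) + (ω₁ + ω₂ - g) / 2))⁻¹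

/-- The measure function `μ(𝐲) = ∏_{i ≠ j} μ(y_i - y_j)`. -/
def muProd (ω₁ ω₂ g : ℂ) {m : ℕ} (y : Fin m → ℝ) : ℂ :=
  ∏ i : Fin m, ∏ j : Fin m, if i ≠ j then mu ω₁ ω₂ g ((y i - y j : ℝ) : ℂ) else 1

/-- `K(𝐱, 𝐲) = ∏_i ∏_j K(x_i - y_j)`. -/
def kerKProd (ω₁ ω₂ g : ℂ) {n m : ℕ} (x : Fin n → ℝ) (y : Fin m → ℝ) : ℂ :=
  ∏ i : Fin n, ∏ j : Fin m, kerK ω₁ ω₂ g ((x i - y j : ℝ) : ℂ)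

/-- The normalizing constant `d_n = (1 / n!) (√(ω₁ ω₂) S₂(g))⁻ⁿ` (principal square root). -/
def dConst (ω₁ ω₂ g : ℂ) (n : ℕ) : ℂ :=
  (1 / (n.factorial : ℂ)) * ((((ω₁ * ω₂) ^ (1 / 2 : ℂ)) * doubleSine ω₁ ω₂ g) ^ n)⁻¹

/-- `e^{2 π i l (x₁ + ⋯ + x_n - y₁ - ⋯ - y_m)} K(𝐱, 𝐲) μ(𝐲)`: for `m = n` the kernel
`Q(𝐱_n, 𝐲_n; l)` of the Baxter operator, for `m = n - 1` the kernel `Λ(𝐱_n, 𝐲_{n-1}; l)` of the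
raising operator. -/
def kernel (ω₁ ω₂ g l : ℂ) {n m : ℕ} (x : Fin n → ℝ) (y : Fin m → ℝ) : ℂ :=
  Complex.exp (2 * Real.pi * Complex.I * l * ((∑ i, x i - ∑ j, y j : ℝ) : ℂ))
    * kerKProd ω₁ ω₂ g x y * muProd ω₁ ω₂ g y

/-- The Baxter operator `Q_n(l)`. -/
def baxterQ (ω₁ ω₂ g l : ℂ) {n : ℕ} (f : (Fin n → ℝ) → ℂ) (x : Fin n → ℝ) : ℂ :=
  dConst ω₁ ω₂ g n * ∫ y : Fin n → ℝ, kernel ω₁ ω₂ g l x y * f y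

/-- The raising operator `Λ_{n+1}(l)`, from functions of `n` to functions of `n + 1` variables. -/
def raising (ω₁ ω₂ g l : ℂ) {n : ℕ} (f : (Fin n → ℝ) → ℂ) (x : Fin (n + 1) → ℝ) : ℂ :=
  dConst ω₁ ω₂ g n * ∫ y : Fin n → ℝ, kernel ω₁ ω₂ g l x y * f y

/-- On functions of no variables the raising operator is an integral over a point:
`Λ_1(l) 1 = e^{2 π i l x₁}`. -/
theorem raising_zero_one (ω₁ ω₂ g l : ℂ) (x : Fin 1 → ℝ) :
    raising ω₁ ω₂ g l (fun _ : Fin 0 → ℝ => 1) x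
      = Complex.exp (2 * Real.pi * Complex.I * l * x 0) := by
  have h : (volume : Measure (Fin 0 → ℝ)) = Measure.dirac isEmptyElim :=
    Measure.volume_pi_eq_dirac _
  rw [raising, h, integral_dirac]
  simp [kernel, dConst, kerKProd, muProd]

/-- The wave function `Ψ_{l_1,…,l_n} = Λ_n(l_n) ⋯ Λ_2(l_2) e^{2 π i l_1 x_1}`, the last factor
being written as `Λ_1(l_1) 1`. -/
def waveFunction (ω₁ ω₂ g : ℂ) : (n : ℕ) → (Fin n → ℂ) → (Fin n → ℝ) → ℂ
  | 0, _, _ => 1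
  | n + 1, l, x =>
      raising ω₁ ω₂ g (l (Fin.last n)) (waveFunction ω₁ ω₂ g n (fun k => l k.castSucc)) x

/-- The integration variables `(𝐲_1, …, 𝐲_{n-1})`, `𝐲_k ∈ ℝᵏ`, of the multiple integral for the
wave function of `n` variables (and a dummy `𝐲_0` in the one-point space `ℝ⁰`). Its volume is the
Lebesgue measure of `ℝ^{n(n-1)/2}`. -/
abbrev Levels (n : ℕ) : Type := (k : Fin n) → Fin (k : ℕ) → ℝ

/-- The integrand, on the space of all integration variables, of the multiple integral
`Ψ_{l_1,…,l_n}(𝐱) = (Λ_n(l_n) ⋯ Λ_2(l_2) e^{2 π i l_1 x_1})(𝐱)`: the product of the kernels and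
constants of the operators. -/
def waveIntegrand (ω₁ ω₂ g : ℂ) : (n : ℕ) → (Fin n → ℂ) → (Fin n → ℝ) → Levels n → ℂ
  | 0, _, _, _ => 1
  | n + 1, l, x, y =>
      dConst ω₁ ω₂ g n * kernel ω₁ ω₂ g (l (Fin.last n)) x (y (Fin.last n))
        * waveIntegrand ω₁ ω₂ g n (fun k => l k.castSucc) (y (Fin.last n))
            (fun k => y k.castSucc)

/-- The integrand of the multiple integral
`(Q_n(lam) Λ_n(l_n) ⋯ Λ_2(l_2) e^{2 π i l_1 x_1})(𝐱)` in the variables `𝐲_n` (first component)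
and `𝐲_1, …, 𝐲_{n-1}` (second component). -/
def baxterWaveIntegrand (ω₁ ω₂ g lam : ℂ) (n : ℕ) (l : Fin n → ℂ) (x : Fin n → ℝ)
    (p : (Fin n → ℝ) × Levels n) : ℂ :=
  dConst ω₁ ω₂ g n * kernel ω₁ ω₂ g lam x p.1 * waveIntegrand ω₁ ω₂ g n l p.1 p.2

/-- The integrand of the multiple integral
`(Λ_{n+1}(l_{n+1}) Q_n(lam) Λ_n(l_n) ⋯ Λ_2(l_2) e^{2 π i l_1 x_1})(𝐱)` in the variables `𝐭_n` of
the operator `Λ_{n+1}` (first component) and those of `Q_n(lam) Λ_n(l_n) ⋯` (second component). -/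
def raisingBaxterWaveIntegrand (ω₁ ω₂ g lam : ℂ) (n : ℕ) (l : Fin (n + 1) → ℂ)
    (x : Fin (n + 1) → ℝ) (p : (Fin n → ℝ) × ((Fin n → ℝ) × Levels n)) : ℂ :=
  dConst ω₁ ω₂ g n * kernel ω₁ ω₂ g (l (Fin.last n)) x p.1
    * baxterWaveIntegrand ω₁ ω₂ g lam n (fun k => l k.castSucc) p.1 p.2

end

end Ruijsenaars

namespace Ruijsenaars

open Filter Asymptotics Set Topology

/-! Put p = π ν_g. Absolute convergence concerns only the moduli of the kernels, and these are
governed by |K(x)| ≤ C e^{-p|x|} and |μ(x) μ(-x)| ≤ C e^{2p|x|}. Both bounds come from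
`exists_bound_doubleSineStrip_mul`: the logarithm of S₂(a + ix) S₂(a - ix) is an integral whose only
part unbounded in x is a multiple of ∫ (1 - cos 2xt)/t² dt = π|x|.

Conjugation by the weight exp(-(p/2) ∑ |x_i - x_j|) turns the resulting kernel bound into exp(p ·
`energy x y`), apart from the λ-exponential. For tuples of equal size, or of sizes n + 1 and n, the
energy is nonpositive, as sorting both tuples shows. It is also at most ‖x‖ - ‖y‖, respectively
2(‖x‖ - ‖y‖), which prevents y from escaping. For equal sizes it is at most -|∑ x_i - ∑ y_i|, which
absorbs the mismatch of spectral parameters in Q.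

A bound by the weight times e^{-2πb ∑ x_i + κ‖x‖} therefore passes through every operator by Tonelli
(`WaveBound.comp`). Each operator increases κ by a small η, and the factor e^{-η‖y‖} gained in
return makes the y-integral finite. Changing b by at most δ in m variables costs a further 2πδm.
Over n levels this gives κ = πδ n(n+1) + nη, and the hypotheses on the λ's keep the total within
what the energy can pay for. -/

/-! ### Convergence of the integral for ln S₂ in the strip -/

/-- Cubic Taylor bound for `sinh`. -/
theorem norm_sinh_sub_self_le {z : ℂ} (hz : ‖z‖ ≤ 1) : ‖Complex.sinh z - z‖ ≤ ‖z‖ ^ 3 := by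
  have h1 := Complex.exp_bound hz (n := 3) (by norm_num)
  have h2 := Complex.exp_bound (x := -z) (by simpa using hz) (n := 3) (by norm_num)
  have e : Complex.sinh z - z
      = ((Complex.exp z - ∑ m ∈ Finset.range 3, z ^ m / m.factorial)
        - (Complex.exp (-z) - ∑ m ∈ Finset.range 3, (-z) ^ m / m.factorial)) / 2 := by
    rw [Complex.sinh]
    simp [Finset.sum_range_succ, Nat.factorial]
    ring
  rw [e, norm_div]
  norm_num [Nat.factorial] at h1 h2 ⊢
  have h3 := norm_sub_le (Complex.exp z - ∑ m ∈ Finset.range 3, z ^ m / m.factorial)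
    (Complex.exp (-z) - ∑ m ∈ Finset.range 3, (-z) ^ m / m.factorial)
  have : 0 ≤ ‖z‖ ^ 3 := by positivity
  linarith

/-- `|sinh z| ≥ sinh (Re z)`. -/
theorem sinh_re_le_norm_sinh (z : ℂ) : Real.sinh z.re ≤ ‖Complex.sinh z‖ := by
  rw [Complex.sinh, norm_div, Real.sinh_eq]
  have := norm_sub_norm_le (Complex.exp z) (Complex.exp (-z))
  simp only [Complex.norm_exp, Complex.neg_re] at this
  norm_num
  linarith

theorem norm_sinh_le (z : ℂ) : ‖Complex.sinh z‖ ≤ Real.exp |z.re| := by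
  rw [Complex.sinh, norm_div]
  have := norm_sub_le (Complex.exp z) (Complex.exp (-z))
  simp only [Complex.norm_exp, Complex.neg_re] at this
  have h1 := Real.exp_le_exp.2 (le_abs_self z.re)
  have h2 := Real.exp_le_exp.2 (neg_le_abs z.re)
  norm_num
  linarith

theorem sinh_mul_ne_zero {ω : ℂ} (hω : 0 < ω.re) {t : ℝ} (ht : 0 < t) :
    Complex.sinh (ω * t) ≠ 0 := by
  have h := sinh_re_le_norm_sinh (ω * t)
  have : 0 < Real.sinh (ω * t).re := Real.sinh_pos_iff.2 (by simp; positivity)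
  exact norm_pos_iff.1 (this.trans_le h)

/-- The integrand of the logarithm of the double sine function, as a function of
`c = 2 z - ω₁ - ω₂`. -/
noncomputable def logSineIntegrand (ω₁ ω₂ c : ℂ) (t : ℝ) : ℂ :=
  (1 / (2 * (t : ℂ))) *
    (Complex.sinh (c * t) / (Complex.sinh (ω₁ * t) * Complex.sinh (ω₂ * t)) - c / (ω₁ * ω₂ * t))

theorem continuousOn_logSineIntegrand {ω₁ ω₂ : ℂ} (h₁ : 0 < ω₁.re) (h₂ : 0 < ω₂.re) (c : ℂ) :
    ContinuousOn (logSineIntegrand ω₁ ω₂ c) (Ioi 0) := by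
  have e₁ : ω₁ ≠ 0 := by rintro rfl; simp at h₁
  have e₂ : ω₂ ≠ 0 := by rintro rfl; simp at h₂
  intro t ht
  have ht' : (t : ℂ) ≠ 0 := by exact_mod_cast (ne_of_gt ht)
  refine ContinuousAt.continuousWithinAt ?_
  unfold logSineIntegrand
  have := sinh_mul_ne_zero h₁ ht
  have := sinh_mul_ne_zero h₂ ht
  have hs : Continuous Complex.sinh := Complex.continuous_sinh
  refine ContinuousAt.mul (ContinuousAt.div (by fun_prop) (by fun_prop) (by simpa using ht'))
    (ContinuousAt.sub (ContinuousAt.div (by fun_prop) (by fun_prop) (by positivity))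
      (ContinuousAt.div (by fun_prop) (by fun_prop) (by positivity)))

theorem isBigO_sinh_mul_sub (a : ℂ) :
    (fun t : ℝ => Complex.sinh (a * t) - a * t) =O[𝓝[>] 0] (fun t : ℝ => (t : ℂ) ^ 3) := by
  refine IsBigO.of_bound (‖a‖ ^ 3) ?_
  have : Tendsto (fun t : ℝ => ‖a * (t : ℂ)‖) (𝓝[>] 0) (𝓝 0) := by
    have : Continuous fun t : ℝ => ‖a * (t : ℂ)‖ := by fun_prop
    simpa using (this.tendsto 0).mono_left nhdsWithin_le_nhds
  filter_upwards [this.eventually_le_const (show (0 : ℝ) < 1 by norm_num)] with t ht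
  refine (norm_sinh_sub_self_le ht).trans (le_of_eq ?_)
  simp [mul_pow]

theorem isBigO_inv_sinh_mul {ω : ℂ} (h : 0 < ω.re) :
    (fun t : ℝ => (Complex.sinh (ω * t))⁻¹) =O[𝓝[>] 0] (fun t : ℝ => ((t : ℂ))⁻¹) := by
  refine IsBigO.of_bound (ω.re)⁻¹ ?_
  filter_upwards [self_mem_nhdsWithin] with t (ht : 0 < t)
  rw [norm_inv, norm_inv, ← mul_inv, Complex.norm_real, Real.norm_of_nonneg ht.le]
  refine inv_anti₀ (by positivity) (le_trans ?_ (sinh_re_le_norm_sinh _))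
  have : (0 : ℝ) ≤ ω.re * t := by positivity
  simpa using Real.self_le_sinh_iff.2 this

/-- Over a common denominator the numerator is ω₁ω₂ t sinh(ct) - c sinh(ω₁t) sinh(ω₂t). Its t² terms
cancel, so it is O(t⁴), as is needed against t² sinh(ω₁t) sinh(ω₂t). -/
theorem isBigO_logSineIntegrand_zero {ω₁ ω₂ : ℂ} (h₁ : 0 < ω₁.re) (h₂ : 0 < ω₂.re) (c : ℂ) :
    logSineIntegrand ω₁ ω₂ c =O[𝓝[>] 0] (fun _ => (1 : ℝ)) := by
  have e₁ : ω₁ ≠ 0 := by rintro rfl; simp at h₁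
  have e₂ : ω₂ ≠ 0 := by rintro rfl; simp at h₂
  have hc := isBigO_sinh_mul_sub c
  have hs₁ := isBigO_sinh_mul_sub ω₁
  have hs₂ := isBigO_sinh_mul_sub ω₂
  have hid : (fun t : ℝ => (t : ℂ)) =O[𝓝[>] 0] (fun t : ℝ => (t : ℂ)) := isBigO_refl _ _
  have hone : (fun t : ℝ => (t : ℂ)) =O[𝓝[>] 0] (fun t : ℝ => (1 : ℂ)) := by
    have : Continuous fun t : ℝ => (t : ℂ) := by fun_prop
    exact ((this.tendsto 0).mono_left nhdsWithin_le_nhds).isBigO_one ℂ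
  have n1 := (hid.mul hc).const_mul_left (ω₁ * ω₂)
  have n2 := (hid.mul hs₂).const_mul_left (c * ω₁)
  have n3 := (hid.mul hs₁).const_mul_left (c * ω₂)
  have n4 := (hs₁.mul hs₂).const_mul_left c
  have n4' : (fun t : ℝ => (t : ℂ) ^ 3 * (t : ℂ) ^ 3) =O[𝓝[>] 0]
      (fun t : ℝ => (t : ℂ) * (t : ℂ) ^ 3) := by
    have := ((hone.mul hone).mul ((hid.mul (isBigO_refl (fun t : ℝ => (t : ℂ) ^ 3) (𝓝[>] 0))))
      )
    refine (this.congr (fun t => ?_) (fun t => ?_))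
    · ring
    · ring
  have num := ((n1.sub n2).sub n3).sub (n4.trans n4')
  have den := (isBigO_inv_sinh_mul h₁).mul (isBigO_inv_sinh_mul h₂)
  have hinv : (fun t : ℝ => ((t : ℂ))⁻¹ * (t : ℂ)⁻¹) =O[𝓝[>] 0]
    (fun t : ℝ => (t : ℂ)⁻¹ * (t : ℂ)⁻¹) := isBigO_refl _ _
  have tot := ((num.mul den).mul hinv).const_mul_left (1 / (2 * ω₁ * ω₂))
  refine ((tot.congr' (f₂ := logSineIntegrand ω₁ ω₂ c) (g₂ := fun _ => (1 : ℂ)) ?_ ?_).trans ?_)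
  · filter_upwards [self_mem_nhdsWithin] with t (ht : 0 < t)
    have ht' : (t : ℂ) ≠ 0 := by exact_mod_cast ht.ne'
    have := sinh_mul_ne_zero h₁ ht
    have := sinh_mul_ne_zero h₂ ht
    unfold logSineIntegrand
    field_simp
    ring
  · filter_upwards [self_mem_nhdsWithin] with t (ht : 0 < t)
    have ht' : (t : ℂ) ≠ 0 := by exact_mod_cast ht.ne'
    field_simp
  · exact IsBigO.of_bound 1 (by simp)

theorem isBigO_inv_sinh_mul_atTop {ω : ℂ} (h : 0 < ω.re) :
    (fun t : ℝ => (Complex.sinh (ω * t))⁻¹) =O[atTop] (fun t : ℝ => Real.exp (-(ω.re * t))) := by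
  refine IsBigO.of_bound 4 ?_
  filter_upwards [eventually_ge_atTop (1 / ω.re), eventually_gt_atTop 0] with t ht ht0
  have h1 : 1 ≤ ω.re * t := by rwa [div_le_iff₀' h] at ht
  have h2 := sinh_re_le_norm_sinh (ω * t)
  have h3 : (ω * t).re = ω.re * t := by simp
  rw [h3, Real.sinh_eq] at h2
  have h4 : Real.exp (-(ω.re * t)) ≤ 1 := Real.exp_le_one_iff.2 (by linarith)
  have h5 : 2 ≤ Real.exp (ω.re * t) := by linarith [Real.add_one_le_exp (ω.re * t)]
  rw [norm_inv, Real.norm_of_nonneg (Real.exp_pos _).le, Real.exp_neg]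
  rw [show (4 : ℝ) * (Real.exp (ω.re * t))⁻¹ = (Real.exp (ω.re * t) / 4)⁻¹ by
    field_simp]
  exact inv_anti₀ (by positivity) (by linarith)

/-- At infinity the two terms are integrable separately: the first decays like exp(-(Re ω₁ + Re ω₂ -
|Re c|) t), the second like t⁻². At 0 only their difference is bounded. -/
theorem integrableOn_logSineIntegrand {ω₁ ω₂ : ℂ} (h₁ : 0 < ω₁.re) (h₂ : 0 < ω₂.re) {c : ℂ}
    (hc : |c.re| < ω₁.re + ω₂.re) : IntegrableOn (logSineIntegrand ω₁ ω₂ c) (Ioi 0) := by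
  have hcont := continuousOn_logSineIntegrand h₁ h₂ c
  have hmeas : AEStronglyMeasurable (logSineIntegrand ω₁ ω₂ c) (volume.restrict (Ioi 0)) :=
    hcont.aestronglyMeasurable measurableSet_Ioi
  rw [integrableOn_Ioi_iff_integrableAtFilter_atTop_nhdsWithin]
  refine ⟨?_, ?_, hcont.locallyIntegrableOn measurableSet_Ioi⟩
  · have e1 : (fun t : ℝ => (1 / (2 * (t : ℂ)))) =O[atTop] (fun t : ℝ => (1 : ℝ)) := by
      refine IsBigO.of_bound 1 ?_
      filter_upwards [eventually_ge_atTop 1] with t ht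
      rw [norm_div, norm_mul, Complex.norm_real, Real.norm_of_nonneg (by linarith)]
      norm_num
      linarith [inv_le_one_of_one_le₀ ht]
    have e2 : (fun t : ℝ => Complex.sinh (c * t)) =O[atTop]
        (fun t : ℝ => Real.exp (|c.re| * t)) := by
      refine IsBigO.of_bound 1 ?_
      filter_upwards [eventually_ge_atTop 0] with t ht
      have := norm_sinh_le (c * t)
      have h3 : (c * t).re = c.re * t := by simp
      rw [h3, abs_mul, abs_of_nonneg ht] at this
      simpa using this
    have e3 := e1.mul (e2.mul ((isBigO_inv_sinh_mul_atTop h₁).mul (isBigO_inv_sinh_mul_atTop h₂)))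
    have i1 : IntegrableAtFilter (fun t : ℝ => Real.exp (-(ω₁.re + ω₂.re - |c.re|) * t)) atTop :=
      ⟨Ioi 0, Ioi_mem_atTop 0, integrableOn_exp_mul_Ioi (by linarith) 0⟩
    have i2 : IntegrableAtFilter (fun t : ℝ => t ^ (-2 : ℝ)) atTop :=
      ⟨Ioi 1, Ioi_mem_atTop 1, integrableOn_Ioi_rpow_of_lt (by norm_num) (by norm_num)⟩
    have i1' : IntegrableAtFilter (fun t : ℝ => (1 / (2 * (t : ℂ))) * (Complex.sinh (c * t) *
        ((Complex.sinh (ω₁ * t))⁻¹ * (Complex.sinh (ω₂ * t))⁻¹))) atTop := by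
      refine IsBigO.integrableAtFilter (e3.congr_right (g₂ := fun t : ℝ =>
        Real.exp (-(ω₁.re + ω₂.re - |c.re|) * t)) fun t => ?_) ?_ i1
      · rw [one_mul, ← Real.exp_add, ← Real.exp_add]
        congr 1
        ring
      · refine Measurable.stronglyMeasurable ?_ |>.stronglyMeasurableAtFilter
        have hs : Measurable Complex.sinh := Complex.measurable_sinh
        fun_prop
    have i2' : IntegrableAtFilter (fun t : ℝ => (1 / (2 * (t : ℂ))) * (c / (ω₁ * ω₂ * t)))
        atTop := by
      refine IsBigO.integrableAtFilter (g := fun t : ℝ => t ^ (-2 : ℝ)) ?_ ?_ i2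
      · refine IsBigO.of_bound (‖c / (2 * ω₁ * ω₂)‖) ?_
        filter_upwards [eventually_gt_atTop 0] with t ht
        have : (t : ℂ) ≠ 0 := by exact_mod_cast ht.ne'
        have e : (1 / (2 * (t : ℂ))) * (c / (ω₁ * ω₂ * t))
            = c / (2 * ω₁ * ω₂) * ((t ^ (-2 : ℝ) : ℝ) : ℂ) := by
          rw [Real.rpow_neg ht.le, Real.rpow_two]
          push_cast
          field_simp
        rw [e, norm_mul, Complex.norm_real]
      · exact (Measurable.stronglyMeasurable (by fun_prop)).stronglyMeasurableAtFilter
    refine (i1'.sub i2').congr ?_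
    filter_upwards with t
    simp only [logSineIntegrand, Pi.sub_apply]
    rw [mul_sub, div_eq_mul_inv (Complex.sinh (c * t)), mul_inv]
  · have hm : StronglyMeasurableAtFilter (logSineIntegrand ω₁ ω₂ c) (𝓝[>] 0) :=
      ⟨Ioi 0, self_mem_nhdsWithin, hmeas⟩
    refine (isBigO_logSineIntegrand_zero h₁ h₂ c).integrableAtFilter hm ?_
    exact ⟨Ioc 0 1, Ioc_mem_nhdsGT one_pos, by simp⟩

/-! ### The integral of (1 - cos at)/t² -/

theorem integral_mul_exp_neg_mul {t : ℝ} (ht : 0 < t) :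
    ∫ s in Ioi (0 : ℝ), s * Real.exp (-(s * t)) = 1 / t ^ 2 := by
  have h := Real.integral_rpow_mul_exp_neg_mul_Ioi (a := 2) (r := t) (by norm_num) ht
  rw [Real.Gamma_two] at h
  norm_num at h
  rw [one_div, ← h]
  refine setIntegral_congr_fun measurableSet_Ioi fun s _ => ?_
  simp only [mul_comm s t]

theorem integrableOn_exp_neg_mul_mul_cos {s : ℝ} (hs : 0 < s) (a : ℝ) :
    IntegrableOn (fun t : ℝ => Real.exp (-(s * t)) * (1 - Real.cos (a * t))) (Ioi 0) ∧
    ∫ t in Ioi (0 : ℝ), Real.exp (-(s * t)) * (1 - Real.cos (a * t))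
      = a ^ 2 / (s * (s ^ 2 + a ^ 2)) := by
  have e : ∀ t : ℝ, Real.exp (-(s * t)) * (1 - Real.cos (a * t))
      = (Complex.exp ((-s : ℂ) * t) - Complex.exp ((-s + a * Complex.I : ℂ) * t)).re := by
    intro t
    simp only [Complex.sub_re, Complex.exp_re]
    simp
    ring
  have r1 : ((-s : ℂ)).re < 0 := by simpa
  have r2 : ((-s + a * Complex.I : ℂ)).re < 0 := by simpa
  have i := (integrableOn_exp_mul_complex_Ioi r1 0).sub (integrableOn_exp_mul_complex_Ioi r2 0)
  have hint : IntegrableOn (fun t : ℝ => Real.exp (-(s * t)) * (1 - Real.cos (a * t)))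
      (Ioi 0) := by
    refine i.re.congr (Eventually.of_forall fun t => ?_)
    exact (e t).symm
  refine ⟨hint, ?_⟩
  have h := integral_re i
  have h' := integral_sub (integrableOn_exp_mul_complex_Ioi r1 0)
    (integrableOn_exp_mul_complex_Ioi r2 0)
  rw [integral_exp_mul_complex_Ioi r1 0, integral_exp_mul_complex_Ioi r2 0] at h'
  calc _ = ∫ t in Ioi (0 : ℝ), (Complex.exp ((-s : ℂ) * t)
        - Complex.exp ((-s + a * Complex.I : ℂ) * t)).re := by simp only [e]
    _ = (∫ t in Ioi (0 : ℝ), (Complex.exp ((-s : ℂ) * t)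
        - Complex.exp ((-s + a * Complex.I : ℂ) * t))).re := h
    _ = _ := by
      rw [h']
      simp [Complex.div_re, Complex.normSq_apply]
      have : s * s + a * a ≠ 0 := by simpa only [sq] using (show s ^ 2 + a ^ 2 ≠ 0 by positivity)
      have : s ^ 2 + a ^ 2 ≠ 0 := by positivity
      field_simp
      ring

theorem integrableOn_div_sq_add_sq (a : ℝ) :
    IntegrableOn (fun s : ℝ => a ^ 2 / (s ^ 2 + a ^ 2)) (Ioi 0) ∧
    ∫ s in Ioi (0 : ℝ), a ^ 2 / (s ^ 2 + a ^ 2) = Real.pi / 2 * |a| := by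
  rcases eq_or_ne a 0 with rfl | ha
  · simp
  have hb : 0 < |a|⁻¹ := by positivity
  have e : ∀ s : ℝ, a ^ 2 / (s ^ 2 + a ^ 2) = (1 + (|a|⁻¹ * s) ^ 2)⁻¹ := by
    intro s
    rw [mul_pow, inv_pow, sq_abs]
    have : s ^ 2 + a ^ 2 ≠ 0 := by positivity
    field_simp
    ring
  simp only [e]
  constructor
  · exact (integrable_inv_one_add_sq.comp_mul_left' hb.ne').integrableOn
  · rw [integral_comp_mul_left_Ioi (fun u : ℝ => (1 + u ^ 2)⁻¹) 0 hb]
    simp [mul_comm]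

/-- The integral `∫₀^∞ (1 - cos (a t)) / t² dt = π |a| / 2`. -/
theorem integrableOn_one_sub_cos_div_sq (a : ℝ) :
    IntegrableOn (fun t : ℝ => (1 - Real.cos (a * t)) / t ^ 2) (Ioi 0) ∧
    ∫ t in Ioi (0 : ℝ), (1 - Real.cos (a * t)) / t ^ 2 = Real.pi / 2 * |a| := by
  -- Since 1/t² = ∫ s e^{-st} ds, the integral is a double integral of a nonnegative function.
  -- Integrating over t first leaves a²/(s² + a²), an arctangent integral.
  set F : ℝ → ℝ → ℝ := fun s t => s * (Real.exp (-(s * t)) * (1 - Real.cos (a * t))) with hF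
  have hmeas : AEStronglyMeasurable (Function.uncurry F)
      ((volume.restrict (Ioi (0 : ℝ))).prod (volume.restrict (Ioi (0 : ℝ)))) := by
    refine Measurable.aestronglyMeasurable ?_
    simp only [hF, Function.uncurry_def]
    fun_prop
  have hpos : ∀ s ∈ Ioi (0 : ℝ), ∀ t : ℝ, 0 ≤ F s t := by
    intro s hs t
    have : 0 < s := hs
    have := Real.cos_le_one (a * t)
    simp only [hF]
    have : 0 ≤ 1 - Real.cos (a * t) := by linarith
    positivity
  have hin : ∀ s ∈ Ioi (0 : ℝ), ∫ t in Ioi (0 : ℝ), F s t = a ^ 2 / (s ^ 2 + a ^ 2) := by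
    intro s (hs : 0 < s)
    simp only [hF]
    rw [integral_const_mul, (integrableOn_exp_neg_mul_mul_cos hs a).2]
    have : s ^ 2 + a ^ 2 ≠ 0 := by positivity
    field_simp
  have hint : Integrable (Function.uncurry F)
      ((volume.restrict (Ioi (0 : ℝ))).prod (volume.restrict (Ioi (0 : ℝ)))) := by
    rw [integrable_prod_iff hmeas]
    constructor
    · filter_upwards [ae_restrict_mem measurableSet_Ioi] with s hs
      exact (integrableOn_exp_neg_mul_mul_cos hs a).1.const_mul s
    · refine ((integrableOn_div_sq_add_sq a).1).congr ?_
      filter_upwards [ae_restrict_mem measurableSet_Ioi] with s hs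
      rw [← hin s hs]
      refine integral_congr_ae (Eventually.of_forall fun t => ?_)
      simp only [Function.uncurry]
      rw [Real.norm_of_nonneg (hpos s hs t)]
  have hout : ∀ t ∈ Ioi (0 : ℝ), ∫ s in Ioi (0 : ℝ), F s t = (1 - Real.cos (a * t)) / t ^ 2 := by
    intro t ht
    simp only [hF, ← mul_assoc]
    rw [integral_mul_const, integral_mul_exp_neg_mul ht]
    ring
  constructor
  · refine (hint.integral_prod_right).congr ?_
    filter_upwards [ae_restrict_mem measurableSet_Ioi] with t ht
    exact hout t ht
  · rw [← setIntegral_congr_fun measurableSet_Ioi hout, ← integral_integral_swap hint,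
      setIntegral_congr_fun measurableSet_Ioi hin]
    exact (integrableOn_div_sq_add_sq a).2

/-! ### Asymptotics of S₂ and of the functions K and μ -/

/-- In the strip, the product of two values of the double sine function at points symmetric with
respect to the horizontal line through `(ω₁ + ω₂ + c) / 2` behaves like
`exp (-π |x| Re (c / (ω₁ ω₂)))`, up to a bounded factor. -/
theorem exists_bound_doubleSineStrip_mul {ω₁ ω₂ : ℂ} (h₁ : 0 < ω₁.re) (h₂ : 0 < ω₂.re) {c : ℂ}
    (hc : |c.re| < ω₁.re + ω₂.re) :
    ∃ M : ℝ, ∀ x : ℝ, ∃ r : ℝ, |r| ≤ M ∧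
      ‖doubleSineStrip ω₁ ω₂ (Complex.I * x + (ω₁ + ω₂ + c) / 2)
        * doubleSineStrip ω₁ ω₂ (-(Complex.I * x) + (ω₁ + ω₂ + c) / 2)‖
      = Real.exp (r - Real.pi * (c / (ω₁ * ω₂)).re * |x|) := by
  have e₁ : ω₁ ≠ 0 := by rintro rfl; simp at h₁
  have e₂ : ω₂ ≠ 0 := by rintro rfl; simp at h₂
  have hstrip : ∀ z : ℂ, doubleSineStrip ω₁ ω₂ z
      = Complex.exp (∫ t in Ioi (0 : ℝ), logSineIntegrand ω₁ ω₂ (2 * z - ω₁ - ω₂) t) :=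
    fun z => rfl
  have hint := integrableOn_logSineIntegrand h₁ h₂ hc
  refine ⟨2 * ∫ t in Ioi (0 : ℝ), ‖logSineIntegrand ω₁ ω₂ c t‖, fun x => ?_⟩
  have hcos := integrableOn_one_sub_cos_div_sq (2 * x)
  have i1 : IntegrableOn (fun t : ℝ => ((Real.cos (2 * x * t) : ℝ) : ℂ)
      * logSineIntegrand ω₁ ω₂ c t) (Ioi 0) := by
    refine hint.bdd_mul (c := 1) (Measurable.aestronglyMeasurable (by fun_prop)) ?_
    refine Eventually.of_forall fun t => ?_
    rw [Complex.norm_real]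
    exact Real.abs_cos_le_one _
  have i2 : IntegrableOn (fun t : ℝ => (((1 - Real.cos (2 * x * t)) / t ^ 2 : ℝ) : ℂ)) (Ioi 0) :=
    hcos.1.ofReal
  have hp : (2 * (Complex.I * x + (ω₁ + ω₂ + c) / 2) - ω₁ - ω₂) = c + 2 * x * Complex.I := by
    ring
  have hm : (2 * (-(Complex.I * x) + (ω₁ + ω₂ + c) / 2) - ω₁ - ω₂) = c + -(2 * x * Complex.I) := by
    ring
  have ip := integrableOn_logSineIntegrand h₁ h₂ (c := c + 2 * x * Complex.I) (by simpa using hc)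
  have im := integrableOn_logSineIntegrand h₁ h₂ (c := c + -(2 * x * Complex.I))
    (by simpa using hc)
  -- The sinh terms add up to 2 sinh(ct) cos(2xt), while the subtracted terms carry no cosine. The
  -- discrepancy is the explicit (1 - cos)/t² term; the rest is dominated by the integrand at x = 0.
  have key : ∀ t ∈ Ioi (0 : ℝ), logSineIntegrand ω₁ ω₂ (c + 2 * x * Complex.I) t
      + logSineIntegrand ω₁ ω₂ (c + -(2 * x * Complex.I)) t
      = 2 * (((Real.cos (2 * x * t) : ℝ) : ℂ) * logSineIntegrand ω₁ ω₂ c t)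
        - c / (ω₁ * ω₂) * (((1 - Real.cos (2 * x * t)) / t ^ 2 : ℝ) : ℂ) := by
    intro t (ht : 0 < t)
    have ht' : (t : ℂ) ≠ 0 := by exact_mod_cast ht.ne'
    have := sinh_mul_ne_zero h₁ ht
    have := sinh_mul_ne_zero h₂ ht
    have hs1 : Complex.sinh ((c + 2 * x * Complex.I) * t)
        = Complex.sinh (c * t) * Complex.cos (2 * x * t)
          + Complex.cosh (c * t) * (Complex.sin (2 * x * t) * Complex.I) := by
      rw [← Complex.cosh_mul_I, ← Complex.sinh_mul_I, ← Complex.sinh_add]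
      congr 1; ring
    have hs2 : Complex.sinh ((c + -(2 * x * Complex.I)) * t)
        = Complex.sinh (c * t) * Complex.cos (2 * x * t)
          - Complex.cosh (c * t) * (Complex.sin (2 * x * t) * Complex.I) := by
      rw [← Complex.cosh_mul_I, ← Complex.sinh_mul_I, ← Complex.sinh_sub]
      congr 1; ring
    simp only [logSineIntegrand, hs1, hs2]
    push_cast
    field_simp
    ring
  rw [hstrip, hstrip, ← Complex.exp_add, hp, hm, ← integral_add ip im,
    setIntegral_congr_fun measurableSet_Ioi key, integral_sub (i1.const_mul 2) (i2.const_mul _),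
    integral_const_mul, integral_const_mul, integral_complex_ofReal, hcos.2, Complex.norm_exp]
  refine ⟨(2 * ∫ t in Ioi (0 : ℝ), ((Real.cos (2 * x * t) : ℝ) : ℂ)
      * logSineIntegrand ω₁ ω₂ c t).re, ?_, ?_⟩
  · refine (Complex.abs_re_le_norm _).trans ?_
    rw [norm_mul, Complex.norm_two]
    refine mul_le_mul_of_nonneg_left ((norm_integral_le_integral_norm _).trans ?_) (by norm_num)
    refine integral_mono i1.norm hint.norm fun t => ?_
    simp only [norm_mul, Complex.norm_real]
    exact mul_le_of_le_one_left (norm_nonneg _) (Real.abs_cos_le_one _)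
  · congr 1
    rw [Complex.sub_re, Complex.re_mul_ofReal, abs_mul, abs_two]
    ring

theorem doubleSine_of_mem_strip {ω₁ ω₂ z : ℂ} (h₁ : 0 < ω₁.re) (hz₀ : 0 < z.re)
    (hz₁ : z.re < (ω₁ + ω₂).re) : doubleSine ω₁ ω₂ z = doubleSineStrip ω₁ ω₂ z := by
  have hf : ⌊1 - z.re / ω₁.re⌋₊ = 0 := by
    rw [Nat.floor_eq_zero]
    have : 0 < z.re / ω₁.re := by positivity
    linarith
  rw [doubleSine, if_pos hz₁, doubleSineLeft]
  simp [hf]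

/-- The imaginary axis bounds the strip: there the floor in `doubleSineLeft` equals 1, so exactly
one shift by ω₁ occurs. -/
theorem doubleSine_of_re_eq_zero {ω₁ ω₂ z : ℂ} (h₁ : 0 < ω₁.re) (h₂ : 0 < ω₂.re)
    (hz : z.re = 0) :
    doubleSine ω₁ ω₂ z
      = 2 * Complex.sin (Real.pi * z / ω₂) * doubleSineStrip ω₁ ω₂ (z + ω₁) := by
  have hlt : z.re < (ω₁ + ω₂).re := by
    rw [hz, Complex.add_re]
    positivity
  rw [doubleSine, if_pos hlt, doubleSineLeft]
  simp [hz]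

theorem measurable_doubleSineStrip (ω₁ ω₂ : ℂ) : Measurable (doubleSineStrip ω₁ ω₂) := by
  have hs : Measurable Complex.sinh := Complex.measurable_sinh
  refine Complex.measurable_exp.comp (StronglyMeasurable.measurable ?_)
  refine StronglyMeasurable.integral_prod_right (f := fun (z : ℂ) (t : ℝ) =>
    (1 / (2 * (t : ℂ))) *
      (Complex.sinh ((2 * z - ω₁ - ω₂) * t) / (Complex.sinh (ω₁ * t) * Complex.sinh (ω₂ * t))
        - (2 * z - ω₁ - ω₂) / (ω₁ * ω₂ * t))) ?_
  refine Measurable.stronglyMeasurable ?_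
  simp only [Function.uncurry_def]
  fun_prop

theorem kerK_ofReal {ω₁ ω₂ g : ℂ} (h₁ : 0 < ω₁.re)
    (hg₀ : 0 < g.re) (hg₁ : g.re < ω₁.re + ω₂.re) (x : ℝ) : kerK ω₁ ω₂ g x
    = (doubleSineStrip ω₁ ω₂ (Complex.I * x + (ω₁ + ω₂ + -g) / 2)
      * doubleSineStrip ω₁ ω₂ (-(Complex.I * x) + (ω₁ + ω₂ + -g) / 2))⁻¹ := by
  have e : ((ω₁ + ω₂ + -g) / 2).re = (ω₁.re + ω₂.re - g.re) / 2 := by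
    simp; ring
  rw [kerK, sub_eq_add_neg, doubleSine_of_mem_strip h₁, doubleSine_of_mem_strip h₁, mul_inv]
  all_goals
    simp only [Complex.add_re, Complex.neg_re, Complex.I_mul_re, Complex.ofReal_im, e]
    linarith

theorem mu_ofReal {ω₁ ω₂ g : ℂ} (h₁ : 0 < ω₁.re) (h₂ : 0 < ω₂.re)
    (hg₀ : 0 < g.re) (hg₁ : g.re < ω₁.re + ω₂.re) (x : ℝ) : mu ω₁ ω₂ g x
    = 2 * Complex.sin (Real.pi * (Complex.I * x) / ω₂)
      * doubleSineStrip ω₁ ω₂ (Complex.I * x + ω₁)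
      * (doubleSineStrip ω₁ ω₂ (Complex.I * x + g))⁻¹ := by
  rw [mu, doubleSine_of_re_eq_zero h₁ h₂ (by simp), doubleSine_of_mem_strip h₁]
  all_goals
    simp only [Complex.add_re, Complex.I_mul_re, Complex.ofReal_im]
    linarith

theorem measurable_kerK {ω₁ ω₂ g : ℂ} (h₁ : 0 < ω₁.re)
    (hg₀ : 0 < g.re) (hg₁ : g.re < ω₁.re + ω₂.re) :
    Measurable fun x : ℝ => kerK ω₁ ω₂ g x := by
  have := measurable_doubleSineStrip ω₁ ω₂
  simp only [kerK_ofReal h₁ hg₀ hg₁]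
  fun_prop

theorem measurable_mu {ω₁ ω₂ g : ℂ} (h₁ : 0 < ω₁.re) (h₂ : 0 < ω₂.re)
    (hg₀ : 0 < g.re) (hg₁ : g.re < ω₁.re + ω₂.re) :
    Measurable fun x : ℝ => mu ω₁ ω₂ g x := by
  have := measurable_doubleSineStrip ω₁ ω₂
  have : Measurable Complex.sin := Complex.measurable_sin
  simp only [mu_ofReal h₁ h₂ hg₀ hg₁]
  fun_prop

/-- Exponential decay of `K` on the real line. -/
theorem exists_norm_kerK_le {ω₁ ω₂ g : ℂ} (h₁ : 0 < ω₁.re) (h₂ : 0 < ω₂.re)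
    (hg₀ : 0 < g.re) (hg₁ : g.re < ω₁.re + ω₂.re) :
    ∃ C : ℝ, 0 < C ∧ ∀ x : ℝ,
    ‖kerK ω₁ ω₂ g x‖ ≤ C * Real.exp (-(Real.pi * nu ω₁ ω₂ g * |x|)) := by
  obtain ⟨M, hM⟩ := exists_bound_doubleSineStrip_mul h₁ h₂ (c := -g)
    (by rw [Complex.neg_re, abs_neg, abs_of_pos hg₀]; exact hg₁)
  refine ⟨Real.exp M, Real.exp_pos _, fun x => ?_⟩
  obtain ⟨r, hr, h⟩ := hM x
  rw [kerK_ofReal h₁ hg₀ hg₁, norm_inv, h, ← Real.exp_neg, ← Real.exp_add, Real.exp_le_exp,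
    neg_div, Complex.neg_re, nu]
  linarith [neg_le_of_abs_le hr]

theorem norm_sin_le (z : ℂ) : ‖Complex.sin z‖ ≤ Real.exp |z.im| := by
  have := norm_sinh_le (z * Complex.I)
  rw [Complex.sinh_mul_I, norm_mul, Complex.norm_I, mul_one] at this
  simpa using this

/-- Exponential growth of `μ(x) μ(-x)` on the real line. -/
theorem exists_norm_mu_mul_mu_neg_le {ω₁ ω₂ g : ℂ} (h₁ : 0 < ω₁.re) (h₂ : 0 < ω₂.re)
    (hg₀ : 0 < g.re) (hg₁ : g.re < ω₁.re + ω₂.re) :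
    ∃ C : ℝ, 1 ≤ C ∧ ∀ x : ℝ,
    ‖mu ω₁ ω₂ g x‖ * ‖mu ω₁ ω₂ g (-x : ℝ)‖
      ≤ C * Real.exp (2 * (Real.pi * nu ω₁ ω₂ g * |x|)) := by
  have e₁ : ω₁ ≠ 0 := by rintro rfl; simp at h₁
  have e₂ : ω₂ ≠ 0 := by rintro rfl; simp at h₂
  -- These two values of c put the centre (ω₁ + ω₂ + c)/2 at ω₁ and at g, the points in the
  -- numerator and the denominator of μ after the shift.
  obtain ⟨M, hM⟩ := exists_bound_doubleSineStrip_mul h₁ h₂ (c := ω₁ - ω₂)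
    (by rw [Complex.sub_re, abs_lt]; constructor <;> linarith)
  obtain ⟨N, hN⟩ := exists_bound_doubleSineStrip_mul h₁ h₂ (c := 2 * g - (ω₁ + ω₂))
    (by
      have : (2 * g - (ω₁ + ω₂)).re = 2 * g.re - (ω₁.re + ω₂.re) := by simp
      rw [this, abs_lt]; constructor <;> linarith)
  have pM : 0 ≤ M := by
    obtain ⟨r, hr, -⟩ := hM 0
    exact (abs_nonneg r).trans hr
  have pN : 0 ≤ N := by
    obtain ⟨r, hr, -⟩ := hN 0
    exact (abs_nonneg r).trans hr
  refine ⟨4 * Real.exp (M + N), ?_, fun x => ?_⟩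
  · linarith [Real.one_le_exp (add_nonneg pM pN)]
  obtain ⟨r, hr, h⟩ := hM x
  obtain ⟨s, hs, k⟩ := hN x
  rw [show (ω₁ + ω₂ + (ω₁ - ω₂)) / 2 = ω₁ by ring] at h
  rw [show (ω₁ + ω₂ + (2 * g - (ω₁ + ω₂))) / 2 = g by ring] at k
  have hre : 0 < (1 / ω₂).re := by
    rw [one_div, Complex.inv_re]
    exact div_pos h₂ (Complex.normSq_pos.2 e₂)
  have im : ∀ y : ℝ, |(Real.pi * (Complex.I * y) / ω₂).im| = Real.pi * (1 / ω₂).re * |y| := by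
    intro y
    have : Real.pi * (Complex.I * y) / ω₂ = ((Real.pi * y : ℝ) : ℂ) * ((1 / ω₂) * Complex.I) := by
      push_cast; field_simp
    rw [this, Complex.im_ofReal_mul, Complex.mul_I_im, abs_mul, abs_mul, abs_of_pos Real.pi_pos,
      abs_of_pos hre]
    ring
  have s1 := norm_sin_le (Real.pi * (Complex.I * x) / ω₂)
  have s2 := norm_sin_le (Real.pi * (Complex.I * (-x : ℝ)) / ω₂)
  rw [im] at s1 s2
  rw [abs_neg] at s2
  have e : ‖mu ω₁ ω₂ g x‖ * ‖mu ω₁ ω₂ g (-x : ℝ)‖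
      = 4 * (‖Complex.sin (Real.pi * (Complex.I * x) / ω₂)‖
        * ‖Complex.sin (Real.pi * (Complex.I * (-x : ℝ)) / ω₂)‖)
        * ‖doubleSineStrip ω₁ ω₂ (Complex.I * x + ω₁)
          * doubleSineStrip ω₁ ω₂ (-(Complex.I * x) + ω₁)‖
        * ‖doubleSineStrip ω₁ ω₂ (Complex.I * x + g)
          * doubleSineStrip ω₁ ω₂ (-(Complex.I * x) + g)‖⁻¹ := by
    rw [mu_ofReal h₁ h₂ hg₀ hg₁, mu_ofReal h₁ h₂ hg₀ hg₁,
      show Complex.I * ((-x : ℝ) : ℂ) = -(Complex.I * x) by push_cast; ring]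
    simp only [norm_mul, norm_inv, Complex.norm_two, mul_inv]
    ring
  have s3 := mul_le_mul s1 s2 (norm_nonneg _) (Real.exp_pos _).le
  rw [e, h, k, ← Real.exp_neg]
  -- The growth of the two sines, 2 Re(1/ω₂), cancels every g-free contribution of the S₂ factors,
  -- leaving 2ν_g.
  have hcalc : Real.pi * (1 / ω₂).re * |x| + Real.pi * (1 / ω₂).re * |x|
      + (r - Real.pi * ((ω₁ - ω₂) / (ω₁ * ω₂)).re * |x|)
      + -(s - Real.pi * ((2 * g - (ω₁ + ω₂)) / (ω₁ * ω₂)).re * |x|)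
      = (r - s) + 2 * (Real.pi * nu ω₁ ω₂ g * |x|) := by
    have : (1 / ω₂).re + (1 / ω₂).re - ((ω₁ - ω₂) / (ω₁ * ω₂)).re
        + ((2 * g - (ω₁ + ω₂)) / (ω₁ * ω₂)).re = 2 * nu ω₁ ω₂ g := by
      have : 1 / ω₂ + 1 / ω₂ - (ω₁ - ω₂) / (ω₁ * ω₂) + (2 * g - (ω₁ + ω₂)) / (ω₁ * ω₂)
          = ((2 : ℝ) : ℂ) * (g / (ω₁ * ω₂)) := by
        push_cast
        field_simp
        ring
      rw [nu, ← Complex.re_ofReal_mul, ← this]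
      simp only [Complex.add_re, Complex.sub_re]
    linear_combination Real.pi * |x| * this
  calc _ ≤ 4 * (Real.exp (Real.pi * (1 / ω₂).re * |x|) * Real.exp (Real.pi * (1 / ω₂).re * |x|))
        * Real.exp (r - Real.pi * ((ω₁ - ω₂) / (ω₁ * ω₂)).re * |x|)
        * Real.exp (-(s - Real.pi * ((2 * g - (ω₁ + ω₂)) / (ω₁ * ω₂)).re * |x|)) := by
        gcongr
    _ = 4 * Real.exp ((r - s) + 2 * (Real.pi * nu ω₁ ω₂ g * |x|)) := by
        rw [← hcalc, Real.exp_add, Real.exp_add, Real.exp_add]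
        ring
    _ ≤ 4 * Real.exp (M + N + 2 * (Real.pi * nu ω₁ ω₂ g * |x|)) := by
        gcongr
        linarith [le_of_abs_le hr, neg_le_of_abs_le hs]
    _ = _ := by rw [Real.exp_add (M + N)]; ring

/-! ### Energy inequalities for point configurations -/

/-- The sum of all distances between the entries of two tuples. -/
noncomputable def pairDist {n m : ℕ} (x : Fin n → ℝ) (y : Fin m → ℝ) : ℝ :=
  ∑ i, ∑ j, |x i - y j|

theorem pairDist_comp_perm {n m : ℕ} (x : Fin n → ℝ) (y : Fin m → ℝ) (σ : Equiv.Perm (Fin n))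
    (τ : Equiv.Perm (Fin m)) : pairDist (x ∘ σ) (y ∘ τ) = pairDist x y := by
  exact (Equiv.sum_comp σ fun i => ∑ j, |x i - y (τ j)|).trans
    (Finset.sum_congr rfl fun i _ => Equiv.sum_comp τ fun j => |x i - y j|)

/-- The energy `½ ∑ |x_i - x_j| + ½ ∑ |y_i - y_j| - ∑ |x_i - y_j|` of the difference of the two
point configurations `x` and `y`. -/
noncomputable def energy {n m : ℕ} (x : Fin n → ℝ) (y : Fin m → ℝ) : ℝ :=
  pairDist x x / 2 + pairDist y y / 2 - pairDist x y

theorem energy_comp_perm {n m : ℕ} (x : Fin n → ℝ) (y : Fin m → ℝ) (σ : Equiv.Perm (Fin n))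
    (τ : Equiv.Perm (Fin m)) : energy (x ∘ σ) (y ∘ τ) = energy x y := by
  simp only [energy, pairDist_comp_perm]

/-- The two differences on the left have the same sign, so they can be regrouped as (b - a) + (d -
c) = (d - a) + (b - c). -/
theorem abs_sub_add_abs_sub_le {a b c d : ℝ} (h : (a ≤ b ∧ c ≤ d) ∨ (b ≤ a ∧ d ≤ c)) :
    |a - b| + |c - d| ≤ |a - d| + |b - c| := by
  rcases h with ⟨h1, h2⟩ | ⟨h1, h2⟩
  · rw [abs_of_nonpos (by linarith : a - b ≤ 0), abs_of_nonpos (by linarith : c - d ≤ 0)]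
    linarith [neg_le_abs (a - d), le_abs_self (b - c)]
  · rw [abs_of_nonneg (by linarith : 0 ≤ a - b), abs_of_nonneg (by linarith : 0 ≤ c - d)]
    linarith [le_abs_self (a - d), neg_le_abs (b - c)]

/-- In twice the energy, the pairs i ≠ j contribute at most 0, because monotone tuples are ordered
alike. The diagonal contributes -2|x_i - y_i|. -/
theorem energy_le_of_monotone {n : ℕ} {x y : Fin n → ℝ} (hx : Monotone x) (hy : Monotone y) :
    energy x y ≤ -∑ i, |x i - y i| := by
  have h : ∀ i j, |x i - x j| + |y i - y j| - |x i - y j| - |x j - y i|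
      ≤ if i = j then -(2 * |x i - y i|) else 0 := by
    intro i j
    split_ifs with hij
    · subst hij
      simp only [sub_self, abs_zero]
      linarith
    · have := abs_sub_add_abs_sub_le (a := x i) (b := x j) (c := y i) (d := y j) (by
        rcases le_total i j with h | h
        · exact Or.inl ⟨hx h, hy h⟩
        · exact Or.inr ⟨hx h, hy h⟩)
      linarith
  have hs := Finset.sum_le_sum fun i (_ : i ∈ Finset.univ) =>
    Finset.sum_le_sum fun j (_ : j ∈ Finset.univ) => h i j
  simp only [Finset.sum_ite_eq, Finset.mem_univ, if_true, Finset.sum_neg_distrib,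
    ← Finset.mul_sum, Finset.sum_sub_distrib, Finset.sum_add_distrib] at hs
  rw [Finset.sum_comm (f := fun i j => |x j - y i|)] at hs
  simp only [energy, pairDist]
  linarith

theorem energy_le_neg_abs_sum_sub {n : ℕ} (x y : Fin n → ℝ) :
    energy x y ≤ -|∑ i, x i - ∑ i, y i| := by
  rw [← energy_comp_perm x y (Tuple.sort x) (Tuple.sort y)]
  refine (energy_le_of_monotone (Tuple.monotone_sort x) (Tuple.monotone_sort y)).trans ?_
  rw [← Equiv.sum_comp (Tuple.sort x) x, ← Equiv.sum_comp (Tuple.sort y) y,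
    ← Finset.sum_sub_distrib, neg_le_neg_iff]
  exact Finset.abs_sum_le_sum_abs _ _

/-- After sorting, a coordinate of y exceeding ‖x‖ in modulus is at least that excess away from its
partner in x, and the energy pays for this distance. -/
theorem energy_le_norm_sub_norm {n : ℕ} (x y : Fin n → ℝ) : energy x y ≤ ‖x‖ - ‖y‖ := by
  have h := energy_le_of_monotone (Tuple.monotone_sort x) (Tuple.monotone_sort y)
  rw [energy_comp_perm] at h
  have h0 : energy x y ≤ 0 :=
    (energy_le_neg_abs_sum_sub x y).trans (neg_nonpos.2 (abs_nonneg _))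
  have : ‖y‖ ≤ ‖x‖ - energy x y := by
    refine (pi_norm_le_iff_of_nonneg (by linarith [norm_nonneg x])).2 fun i => ?_
    obtain ⟨j, rfl⟩ := (Tuple.sort y).surjective i
    have h1 := Finset.single_le_sum
      (f := fun i => |(x ∘ Tuple.sort x) i - (y ∘ Tuple.sort y) i|)
      (fun _ _ => abs_nonneg _) (Finset.mem_univ j)
    have h2 := norm_le_pi_norm x (Tuple.sort x j)
    simp only [Function.comp, Real.norm_eq_abs] at h1 h2 ⊢ h
    have h3 := abs_sub_abs_le_abs_sub (y (Tuple.sort y j)) (x (Tuple.sort x j))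
    rw [abs_sub_comm] at h3
    linarith
  linarith

/-- The largest point of x is split off and the equal-size estimate is applied to the others. Each
summand is twice the distance from y_i to the interval between x_i and the largest point; this is
the source of the factor 2 in `energy_succ_le_norm_sub_norm`. -/
theorem energy_succ_le_of_monotone {n : ℕ} {x : Fin (n + 1) → ℝ} {y : Fin n → ℝ}
    (hx : Monotone x) (hy : Monotone y) :
    energy x y ≤ -∑ i : Fin n, (|x (Fin.last n) - y i| + |x i.castSucc - y i|
      - |x i.castSucc - x (Fin.last n)|) := by
  have h := energy_le_of_monotone (x := fun i => x i.castSucc)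
    (fun i j hij => hx (Fin.castSucc_le_castSucc_iff.2 hij)) hy
  have h1 : pairDist x x = pairDist (fun i : Fin n => x i.castSucc) (fun i : Fin n => x i.castSucc)
      + 2 * ∑ i : Fin n, |x i.castSucc - x (Fin.last n)| := by
    simp only [pairDist, Fin.sum_univ_castSucc, Finset.sum_add_distrib, sub_self, abs_zero,
      add_zero, fun i : Fin n => abs_sub_comm (x (Fin.last n)) (x i.castSucc)]
    ring
  have h2 : pairDist x y = pairDist (fun i : Fin n => x i.castSucc) y
      + ∑ i : Fin n, |x (Fin.last n) - y i| := by
    simp only [pairDist, Fin.sum_univ_castSucc]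
  simp only [energy] at h ⊢
  rw [h1, h2]
  simp only [Finset.sum_sub_distrib, Finset.sum_add_distrib]
  linarith

theorem abs_sub_add_abs_sub_sub_nonneg (a b c : ℝ) : 0 ≤ |b - c| + |a - c| - |a - b| := by
  have := abs_sub_le a c b
  rw [abs_sub_comm c b] at this
  linarith

theorem energy_succ_nonpos {n : ℕ} (x : Fin (n + 1) → ℝ) (y : Fin n → ℝ) : energy x y ≤ 0 := by
  rw [← energy_comp_perm x y (Tuple.sort x) (Tuple.sort y)]
  refine (energy_succ_le_of_monotone (Tuple.monotone_sort x) (Tuple.monotone_sort y)).trans ?_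
  exact neg_nonpos.2 (Finset.sum_nonneg fun i _ => abs_sub_add_abs_sub_sub_nonneg _ _ _)

theorem energy_succ_le_norm_sub_norm {n : ℕ} (x : Fin (n + 1) → ℝ) (y : Fin n → ℝ) :
    energy x y ≤ 2 * (‖x‖ - ‖y‖) := by
  have h0 := energy_succ_nonpos x y
  have h := energy_succ_le_of_monotone (Tuple.monotone_sort x) (Tuple.monotone_sort y)
  rw [energy_comp_perm] at h
  have : ‖y‖ ≤ ‖x‖ - energy x y / 2 := by
    refine (pi_norm_le_iff_of_nonneg (by linarith [norm_nonneg x])).2 fun i => ?_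
    obtain ⟨j, rfl⟩ := (Tuple.sort y).surjective i
    have h1 := Finset.single_le_sum (f := fun i : Fin n =>
      |(x ∘ Tuple.sort x) (Fin.last n) - (y ∘ Tuple.sort y) i|
        + |(x ∘ Tuple.sort x) i.castSucc - (y ∘ Tuple.sort y) i|
        - |(x ∘ Tuple.sort x) i.castSucc - (x ∘ Tuple.sort x) (Fin.last n)|)
      (fun _ _ => abs_sub_add_abs_sub_sub_nonneg _ _ _) (Finset.mem_univ j)
    have h2 := norm_le_pi_norm x (Tuple.sort x j.castSucc)
    have h3 := norm_le_pi_norm x (Tuple.sort x (Fin.last n))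
    have hm := (Tuple.monotone_sort x) (Fin.le_last j.castSucc)
    simp only [Function.comp, Real.norm_eq_abs] at h h1 h2 h3 hm ⊢
    rw [abs_of_nonpos (sub_nonpos.2 hm)] at h1
    rw [abs_le] at h2 h3
    rw [abs_le]
    have a1 := le_abs_self (x (Tuple.sort x (Fin.last n)) - y (Tuple.sort y j))
    have a2 := neg_le_abs (x (Tuple.sort x (Fin.last n)) - y (Tuple.sort y j))
    have a3 := le_abs_self (x (Tuple.sort x j.castSucc) - y (Tuple.sort y j))
    have a4 := neg_le_abs (x (Tuple.sort x j.castSucc) - y (Tuple.sort y j))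
    constructor <;> linarith
  linarith

/-! ### Bounds on the kernels of the operators -/

theorem exists_norm_muProd_le {ω₁ ω₂ g : ℂ} (h₁ : 0 < ω₁.re) (h₂ : 0 < ω₂.re) (hg₀ : 0 < g.re)
    (hg₁ : g.re < ω₁.re + ω₂.re) (m : ℕ) :
    ∃ C : ℝ, 0 ≤ C ∧ ∀ y : Fin m → ℝ, ‖muProd ω₁ ω₂ g y‖
      ≤ C * Real.exp (Real.pi * nu ω₁ ω₂ g * pairDist y y) := by
  obtain ⟨C, hC, hb⟩ := exists_norm_mu_mul_mu_neg_le h₁ h₂ hg₀ hg₁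
  refine ⟨C ^ (m * m), by positivity, fun y => ?_⟩
  set a : Fin m → Fin m → ℝ :=
    fun i j => ‖if i ≠ j then mu ω₁ ω₂ g ((y i - y j : ℝ) : ℂ) else 1‖ with ha
  have hn : ‖muProd ω₁ ω₂ g y‖ = ∏ i, ∏ j, a i j := by
    simp only [muProd, norm_prod, ha]
  -- Squaring pairs each μ(y_i - y_j) with μ(y_j - y_i), since only this product has been bounded.
  -- The bound C ≥ 1 covers the diagonal factors and the final passage from C^(m²) to its square.
  have hsq : ‖muProd ω₁ ω₂ g y‖ ^ 2 = ∏ i, ∏ j, a i j * a j i := by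
    rw [sq]
    nth_rewrite 2 [hn]
    rw [Finset.prod_comm, hn]
    simp only [← Finset.prod_mul_distrib]
  have hle : ∀ i j, a i j * a j i
      ≤ C * Real.exp (2 * (Real.pi * nu ω₁ ω₂ g * |y i - y j|)) := by
    intro i j
    by_cases hij : i = j
    · simp [ha, hij, hC]
    · have := hb (y i - y j)
      rw [neg_sub] at this
      simpa [ha, hij, Ne.symm hij] using this
  have hC0 : 0 ≤ C := by linarith
  have h : ‖muProd ω₁ ω₂ g y‖ ^ 2
      ≤ (C ^ (m * m) * Real.exp (Real.pi * nu ω₁ ω₂ g * pairDist y y)) ^ 2 := by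
    rw [hsq]
    calc _ ≤ ∏ i : Fin m, ∏ j : Fin m,
          C * Real.exp (2 * (Real.pi * nu ω₁ ω₂ g * |y i - y j|)) :=
          Finset.prod_le_prod (fun i _ => Finset.prod_nonneg fun j _ => by positivity) fun i _ =>
            Finset.prod_le_prod (fun j _ => by positivity) fun j _ => hle i j
      _ = C ^ (m * m) * Real.exp (Real.pi * nu ω₁ ω₂ g * pairDist y y) ^ 2 := by
          simp only [Finset.prod_mul_distrib, Finset.prod_const, Finset.card_univ,
            Fintype.card_fin, ← pow_mul, ← Real.exp_sum, ← Real.exp_nat_mul, ← Finset.mul_sum,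
            pairDist]
          push_cast
          ring_nf
      _ ≤ _ := by
          rw [mul_pow]
          gcongr
          exact le_self_pow₀ (one_le_pow₀ hC) two_ne_zero
  exact (pow_le_pow_iff_left₀ (norm_nonneg _) (by positivity) two_ne_zero).1 h

theorem exists_norm_kerKProd_le {ω₁ ω₂ g : ℂ} (h₁ : 0 < ω₁.re) (h₂ : 0 < ω₂.re) (hg₀ : 0 < g.re)
    (hg₁ : g.re < ω₁.re + ω₂.re) (n m : ℕ) :
    ∃ C : ℝ, 0 ≤ C ∧ ∀ (x : Fin n → ℝ) (y : Fin m → ℝ), ‖kerKProd ω₁ ω₂ g x y‖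
      ≤ C * Real.exp (-(Real.pi * nu ω₁ ω₂ g * pairDist x y)) := by
  obtain ⟨C, hC, hb⟩ := exists_norm_kerK_le h₁ h₂ hg₀ hg₁
  refine ⟨C ^ (m * n), by positivity, fun x y => ?_⟩
  simp only [kerKProd, norm_prod]
  calc _ ≤ ∏ i : Fin n, ∏ j : Fin m,
        C * Real.exp (-(Real.pi * nu ω₁ ω₂ g * |x i - y j|)) :=
        Finset.prod_le_prod (fun i _ => by positivity) fun i _ =>
          Finset.prod_le_prod (fun j _ => by positivity) fun j _ => hb _
    _ = _ := by
        simp only [Finset.prod_mul_distrib, Finset.prod_const, Finset.card_univ,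
          Fintype.card_fin, ← pow_mul, ← Real.exp_sum, ← Finset.mul_sum, pairDist,
          Finset.sum_neg_distrib]

theorem exists_norm_kernel_le {ω₁ ω₂ g : ℂ} (h₁ : 0 < ω₁.re) (h₂ : 0 < ω₂.re) (hg₀ : 0 < g.re)
    (hg₁ : g.re < ω₁.re + ω₂.re) (l : ℂ) (n m : ℕ) :
    ∃ C : ℝ, 0 ≤ C ∧ ∀ (x : Fin n → ℝ) (y : Fin m → ℝ),
      ‖dConst ω₁ ω₂ g m * kernel ω₁ ω₂ g l x y‖ ≤ C * Real.exp
        (-(2 * Real.pi * l.im * (∑ i, x i - ∑ j, y j))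
          + Real.pi * nu ω₁ ω₂ g * (pairDist y y - pairDist x y)) := by
  obtain ⟨C, hC, hc⟩ := exists_norm_muProd_le h₁ h₂ hg₀ hg₁ m
  obtain ⟨D, hD, hd⟩ := exists_norm_kerKProd_le h₁ h₂ hg₀ hg₁ n m
  refine ⟨‖dConst ω₁ ω₂ g m‖ * (D * C), by positivity, fun x y => ?_⟩
  have he : ‖Complex.exp (2 * Real.pi * Complex.I * l * ((∑ i, x i - ∑ j, y j : ℝ) : ℂ))‖
      = Real.exp (-(2 * Real.pi * l.im * (∑ i, x i - ∑ j, y j))) := by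
    rw [Complex.norm_exp, Complex.re_mul_ofReal]
    congr 1
    simp
  rw [kernel, norm_mul, norm_mul, norm_mul, he, Real.exp_add,
    mul_sub (Real.pi * nu ω₁ ω₂ g), sub_eq_add_neg (_ * pairDist y y),
    Real.exp_add (_ * pairDist y y)]
  calc _ ≤ ‖dConst ω₁ ω₂ g m‖ * (Real.exp (-(2 * Real.pi * l.im * (∑ i, x i - ∑ j, y j)))
        * (D * Real.exp (-(Real.pi * nu ω₁ ω₂ g * pairDist x y)))
        * (C * Real.exp (Real.pi * nu ω₁ ω₂ g * pairDist y y))) := by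
        gcongr
        · exact hd x y
        · exact hc y
    _ = _ := by ring

theorem measurable_kernel {ω₁ ω₂ g : ℂ} (h₁ : 0 < ω₁.re) (h₂ : 0 < ω₂.re) (hg₀ : 0 < g.re)
    (hg₁ : g.re < ω₁.re + ω₂.re) (l : ℂ) (n m : ℕ) :
    Measurable fun q : (Fin n → ℝ) × (Fin m → ℝ) => kernel ω₁ ω₂ g l q.1 q.2 := by
  have hK := measurable_kerK h₁ hg₀ hg₁
  have hM := measurable_mu h₁ h₂ hg₀ hg₁
  unfold kernel kerKProd muProd
  refine Measurable.mul (Measurable.mul (by fun_prop) ?_) ?_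
  · refine Finset.measurable_prod _ fun i _ => Finset.measurable_prod _ fun j _ => ?_
    exact hK.comp (f := fun q : (Fin n → ℝ) × (Fin m → ℝ) => q.1 i - q.2 j) (by fun_prop)
  · refine Finset.measurable_prod _ fun i _ => Finset.measurable_prod _ fun j _ => ?_
    split_ifs
    · exact hM.comp (f := fun q : (Fin n → ℝ) × (Fin m → ℝ) => q.2 i - q.2 j) (by fun_prop)
    · exact measurable_const

/-! ### Weighted bounds and their passage through the operators -/

theorem integrable_exp_neg_mul_abs {c : ℝ} (hc : 0 < c) :
    Integrable fun t : ℝ => Real.exp (-(c * |t|)) := by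
  rw [← integrableOn_univ, ← Iic_union_Ioi (a := (0 : ℝ))]
  refine IntegrableOn.union ?_ ?_
  · refine (integrableOn_exp_mul_Iic hc 0).congr_fun (fun t (ht : t ≤ 0) => ?_) measurableSet_Iic
    simp [abs_of_nonpos ht]
  · refine (integrableOn_exp_mul_Ioi (neg_lt_zero.2 hc) 0).congr_fun (fun t (ht : 0 < t) => ?_)
      measurableSet_Ioi
    simp [abs_of_pos ht]

theorem integrable_exp_neg_mul_norm {η : ℝ} (hη : 0 < η) (m : ℕ) :
    Integrable fun y : Fin m → ℝ => Real.exp (-(η * ‖y‖)) := by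
  -- The rate η/m comes from ∑ |y_i| ≤ m‖y‖ for the sup norm. For m = 0 the product is empty, and
  -- m/m ≤ 1 still holds.
  have h : Integrable fun y : Fin m → ℝ => ∏ i, Real.exp (-(η / m * |y i|)) :=
    Integrable.fintype_prod (f := fun _ t => Real.exp (-(η / m * |t|))) fun i =>
      integrable_exp_neg_mul_abs (div_pos hη (by exact_mod_cast i.pos))
  refine h.mono' (Measurable.aestronglyMeasurable (by fun_prop)) (Eventually.of_forall fun y => ?_)
  rw [Real.norm_of_nonneg (Real.exp_pos _).le, ← Real.exp_sum, Real.exp_le_exp,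
    Finset.sum_neg_distrib, neg_le_neg_iff, ← Finset.mul_sum]
  have h1 : ∑ i, |y i| ≤ m * ‖y‖ := by
    have := Finset.sum_le_card_nsmul Finset.univ (fun i => |y i|) ‖y‖
      fun i _ => norm_le_pi_norm y i
    simpa using this
  calc η / m * ∑ i, |y i| ≤ η / m * (m * ‖y‖) := by gcongr
    _ = η * ((m / m : ℝ) * ‖y‖) := by ring
    _ ≤ η * (1 * ‖y‖) := by
      gcongr
      exact div_self_le_one _
    _ = η * ‖y‖ := by ring

/-- The exponent in the bounds on the wave functions. -/
noncomputable def waveExponent (p b κ : ℝ) {n : ℕ} (x : Fin n → ℝ) : ℝ :=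
  -(p / 2 * pairDist x x) - 2 * Real.pi * b * ∑ i, x i + κ * ‖x‖

/-- The integrand `F x z` is jointly measurable, and the integral of its absolute value over `z`
is bounded by a multiple of `exp (waveExponent p b κ x)`. -/
def WaveBound {Z : Type*} [MeasureSpace Z] (p b κ : ℝ) {n : ℕ} (F : (Fin n → ℝ) → Z → ℂ) : Prop :=
  Measurable (Function.uncurry F) ∧ ∃ C : ℝ, 0 ≤ C ∧ ∀ x,
    ∫⁻ z, ‖F x z‖ₑ ≤ ENNReal.ofReal (C * Real.exp (waveExponent p b κ x))

section

variable {Z : Type*} [MeasureSpace Z] {p b κ : ℝ} {n m : ℕ}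

theorem WaveBound.integrable {F : (Fin n → ℝ) → Z → ℂ} (h : WaveBound p b κ F) (x : Fin n → ℝ) :
    Integrable (F x) := by
  obtain ⟨hm, C, -, hC⟩ := h
  exact ⟨(hm.comp measurable_prodMk_left).aestronglyMeasurable,
    (hC x).trans_lt ENNReal.ofReal_lt_top⟩

/-- As |∑ x_i| ≤ n‖x‖, a change of b can be charged to κ. -/
theorem WaveBound.mono {F : (Fin n → ℝ) → Z → ℂ} (h : WaveBound p b κ F) {b' κ' : ℝ}
    (hb : 2 * Real.pi * |b' - b| * n + κ ≤ κ') : WaveBound p b' κ' F := by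
  obtain ⟨hm, C, hC0, hC⟩ := h
  refine ⟨hm, C, hC0, fun x => (hC x).trans (ENNReal.ofReal_le_ofReal ?_)⟩
  gcongr
  have h1 : |∑ i, x i| ≤ n * ‖x‖ := by
    refine (Finset.abs_sum_le_sum_abs _ _).trans ?_
    have := Finset.sum_le_card_nsmul Finset.univ (fun i => |x i|) ‖x‖
      fun i _ => norm_le_pi_norm x i
    simpa using this
  have h2 : 2 * Real.pi * (b' - b) * ∑ i, x i ≤ 2 * Real.pi * |b' - b| * n * ‖x‖ := by
    calc _ = 2 * Real.pi * ((b' - b) * ∑ i, x i) := by ring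
      _ ≤ 2 * Real.pi * (|b' - b| * (n * ‖x‖)) := by
        refine mul_le_mul_of_nonneg_left ((le_abs_self _).trans ?_) (by positivity)
        rw [abs_mul]
        exact mul_le_mul_of_nonneg_left h1 (abs_nonneg _)
      _ = _ := by ring
  have h3 := mul_le_mul_of_nonneg_right hb (norm_nonneg x)
  simp only [waveExponent]
  linarith

/-- By Tonelli the inner integral is replaced by its bound; the spare factor e^{-η‖y‖} then makes
the y-integral finite, uniformly in x. -/
theorem WaveBound.comp [SFinite (volume : Measure Z)] {F : (Fin m → ℝ) → Z → ℂ}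
    (h : WaveBound p b κ F)
    {k : (Fin n → ℝ) → (Fin m → ℝ) → ℂ} (hk : Measurable (Function.uncurry k)) {κ' η : ℝ}
    (hη : 0 < η) (hb : ∃ C : ℝ, 0 ≤ C ∧ ∀ x y, ‖k x y‖ * Real.exp (waveExponent p b κ y)
      ≤ C * Real.exp (waveExponent p b κ' x) * Real.exp (-(η * ‖y‖))) :
    WaveBound p b κ' (fun x (q : (Fin m → ℝ) × Z) => k x q.1 * F q.1 q.2) := by
  obtain ⟨hm, C, hC0, hC⟩ := h
  obtain ⟨D, hD0, hD⟩ := hb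
  have hmeas : Measurable (Function.uncurry
      (fun x (q : (Fin m → ℝ) × Z) => k x q.1 * F q.1 q.2)) :=
    Measurable.mul
      (hk.comp (f := fun r : (Fin n → ℝ) × ((Fin m → ℝ) × Z) => (r.1, r.2.1)) (by fun_prop))
      (hm.comp (f := fun r : (Fin n → ℝ) × ((Fin m → ℝ) × Z) => r.2) (by fun_prop))
  have hint := integrable_exp_neg_mul_norm hη m
  refine ⟨hmeas, C * D * ∫ y : Fin m → ℝ, Real.exp (-(η * ‖y‖)), by positivity, fun x => ?_⟩
  have hpt : ∀ y, ‖k x y‖ₑ * ENNReal.ofReal (C * Real.exp (waveExponent p b κ y))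
      ≤ ENNReal.ofReal (C * D * Real.exp (waveExponent p b κ' x) * Real.exp (-(η * ‖y‖))) := by
    intro y
    rw [← ofReal_norm, ← ENNReal.ofReal_mul (norm_nonneg _)]
    refine ENNReal.ofReal_le_ofReal ?_
    have := mul_le_mul_of_nonneg_left (hD x y) hC0
    linarith
  calc ∫⁻ q : (Fin m → ℝ) × Z, ‖k x q.1 * F q.1 q.2‖ₑ
      = ∫⁻ y, ∫⁻ z, ‖k x y * F y z‖ₑ := by
        refine lintegral_prod _ ?_
        exact (hmeas.comp measurable_prodMk_left).enorm.aemeasurable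
    _ = ∫⁻ y, ‖k x y‖ₑ * ∫⁻ z, ‖F y z‖ₑ := by
        refine lintegral_congr fun y => ?_
        simp only [enorm_mul]
        exact lintegral_const_mul _ (hm.comp measurable_prodMk_left).enorm
    _ ≤ ∫⁻ y, ENNReal.ofReal
          (C * D * Real.exp (waveExponent p b κ' x) * Real.exp (-(η * ‖y‖))) :=
        lintegral_mono fun y => (mul_le_mul_right (hC y) _).trans (hpt y)
    _ = ENNReal.ofReal (∫ y : Fin m → ℝ,
          C * D * Real.exp (waveExponent p b κ' x) * Real.exp (-(η * ‖y‖))) :=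
        (ofReal_integral_eq_lintegral_ofReal (hint.const_mul _)
          (Eventually.of_forall fun y => by positivity)).symm
    _ = _ := by
        rw [integral_const_mul]
        ring_nf

end

section

variable {ω₁ ω₂ g : ℂ} {Z : Type*} [MeasureSpace Z]

theorem integral_kernel_mul [SFinite (volume : Measure Z)] {n m : ℕ} (l : ℂ) {x : Fin n → ℝ}
    {F : (Fin m → ℝ) → Z → ℂ} {f : (Fin m → ℝ) → ℂ} (hf : ∀ y, f y = ∫ z, F y z)
    (hint : Integrable fun q : (Fin m → ℝ) × Z =>
      dConst ω₁ ω₂ g m * kernel ω₁ ω₂ g l x q.1 * F q.1 q.2) :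
    dConst ω₁ ω₂ g m * ∫ y, kernel ω₁ ω₂ g l x y * f y
      = ∫ q : (Fin m → ℝ) × Z, dConst ω₁ ω₂ g m * kernel ω₁ ω₂ g l x q.1 * F q.1 q.2 := by
  rw [Measure.volume_eq_prod] at hint ⊢
  rw [integral_prod _ hint, ← integral_const_mul]
  refine integral_congr_ae (Eventually.of_forall fun y => ?_)
  simp only [integral_const_mul, hf, mul_assoc]

theorem measurable_dConst_mul_kernel (h₁ : 0 < ω₁.re) (h₂ : 0 < ω₂.re) (hg₀ : 0 < g.re)
    (hg₁ : g.re < ω₁.re + ω₂.re) (l : ℂ) (n m : ℕ) :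
    Measurable (Function.uncurry fun (x : Fin n → ℝ) (y : Fin m → ℝ) =>
      dConst ω₁ ω₂ g m * kernel ω₁ ω₂ g l x y) :=
  (measurable_kernel h₁ h₂ hg₀ hg₁ l n m).const_mul _

/-- The raising operator preserves exponential bounds. -/
theorem WaveBound.raising [SFinite (volume : Measure Z)] (h₁ : 0 < ω₁.re) (h₂ : 0 < ω₂.re)
    (hg₀ : 0 < g.re) (hg₁ : g.re < ω₁.re + ω₂.re) (hν : 0 < nu ω₁ ω₂ g) {n : ℕ} {κ η : ℝ} {l : ℂ}
    (hκ : 0 ≤ κ) (hη : 0 < η) (hle : κ + η ≤ 2 * (Real.pi * nu ω₁ ω₂ g))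
    {F : (Fin n → ℝ) → Z → ℂ} (hF : WaveBound (Real.pi * nu ω₁ ω₂ g) l.im κ F) :
    WaveBound (Real.pi * nu ω₁ ω₂ g) l.im (κ + η)
      (fun (x : Fin (n + 1) → ℝ) (q : (Fin n → ℝ) × Z) =>
        dConst ω₁ ω₂ g n * kernel ω₁ ω₂ g l x q.1 * F q.1 q.2) := by
  refine hF.comp (measurable_dConst_mul_kernel h₁ h₂ hg₀ hg₁ l (n + 1) n) hη ?_
  obtain ⟨C, hC0, hC⟩ := exists_norm_kernel_le h₁ h₂ hg₀ hg₁ l (n + 1) n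
  refine ⟨C, hC0, fun x y => ?_⟩
  refine (mul_le_mul_of_nonneg_right (hC x y) (Real.exp_pos _).le).trans ?_
  rw [mul_assoc C, mul_assoc C, ← Real.exp_add, ← Real.exp_add]
  refine mul_le_mul_of_nonneg_left (Real.exp_le_exp.2 ?_) hC0
  have e1 := energy_succ_nonpos x y
  have e2 := energy_succ_le_norm_sub_norm x y
  have hp : 0 < Real.pi * nu ω₁ ω₂ g := mul_pos Real.pi_pos hν
  -- The λ-exponentials cancel, as b is the imaginary part of l. If ‖y‖ ≤ ‖x‖, nonpositivity of the
  -- energy suffices; otherwise its decay rate 2p dominates κ + η.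
  have key : Real.pi * nu ω₁ ω₂ g * energy x y ≤ (κ + η) * (‖x‖ - ‖y‖) := by
    rcases le_total ‖y‖ ‖x‖ with h | h
    · exact (mul_nonpos_of_nonneg_of_nonpos hp.le e1).trans
        (mul_nonneg (by linarith) (sub_nonneg.2 h))
    · calc _ ≤ Real.pi * nu ω₁ ω₂ g * (2 * (‖x‖ - ‖y‖)) := by gcongr
        _ = 2 * (Real.pi * nu ω₁ ω₂ g) * (‖x‖ - ‖y‖) := by ring
        _ ≤ _ := mul_le_mul_of_nonpos_right hle (sub_nonpos.2 h)
  simp only [energy] at key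
  simp only [waveExponent]
  linarith

/-- The Baxter operator preserves exponential bounds. -/
theorem WaveBound.baxter [SFinite (volume : Measure Z)] (h₁ : 0 < ω₁.re) (h₂ : 0 < ω₂.re)
    (hg₀ : 0 < g.re) (hg₁ : g.re < ω₁.re + ω₂.re) {n : ℕ} {b κ η : ℝ} {l : ℂ}
    (hκ : 0 ≤ κ) (hη : 0 < η)
    (hle : 2 * Real.pi * |l.im - b| + (κ + η) ≤ Real.pi * nu ω₁ ω₂ g)
    {F : (Fin n → ℝ) → Z → ℂ} (hF : WaveBound (Real.pi * nu ω₁ ω₂ g) b κ F) :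
    WaveBound (Real.pi * nu ω₁ ω₂ g) b (κ + η)
      (fun (x : Fin n → ℝ) (q : (Fin n → ℝ) × Z) =>
        dConst ω₁ ω₂ g n * kernel ω₁ ω₂ g l x q.1 * F q.1 q.2) := by
  refine hF.comp (measurable_dConst_mul_kernel h₁ h₂ hg₀ hg₁ l n n) hη ?_
  obtain ⟨C, hC0, hC⟩ := exists_norm_kernel_le h₁ h₂ hg₀ hg₁ l n n
  refine ⟨C, hC0, fun x y => ?_⟩
  refine (mul_le_mul_of_nonneg_right (hC x y) (Real.exp_pos _).le).trans ?_
  rw [mul_assoc C, mul_assoc C, ← Real.exp_add, ← Real.exp_add]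
  refine mul_le_mul_of_nonneg_left (Real.exp_le_exp.2 ?_) hC0
  have e1 := energy_le_neg_abs_sum_sub x y
  have e2 := energy_le_norm_sub_norm x y
  have a0 : energy x y ≤ 0 := e1.trans (neg_nonpos.2 (abs_nonneg _))
  -- Part of the negative energy pays for the mismatch between Im l and b; by `hle` at least the
  -- fraction κ + η remains to control ‖y‖.
  have k1 : -(2 * Real.pi * (l.im - b) * (∑ i, x i - ∑ i, y i))
      ≤ 2 * Real.pi * |l.im - b| * -energy x y := by
    calc _ = 2 * Real.pi * -((l.im - b) * (∑ i, x i - ∑ i, y i)) := by ring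
      _ ≤ 2 * Real.pi * (|l.im - b| * -energy x y) := by
        refine mul_le_mul_of_nonneg_left ((neg_le_abs _).trans ?_) (by positivity)
        rw [abs_mul]
        exact mul_le_mul_of_nonneg_left (le_neg_of_le_neg e1) (abs_nonneg _)
      _ = _ := by ring
  have k2 := mul_le_mul_of_nonneg_left e2 (add_nonneg hκ hη.le)
  have k3 := mul_le_mul_of_nonneg_right hle (neg_nonneg.2 a0)
  have e : energy x y = pairDist x x / 2 + pairDist y y / 2 - pairDist x y := rfl
  have k4 : Real.pi * nu ω₁ ω₂ g * energy x y
      = Real.pi * nu ω₁ ω₂ g * (pairDist x x / 2 + pairDist y y / 2 - pairDist x y) := by rw [e]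
  simp only [waveExponent]
  linarith

end

/-! ### Induction over the levels of the wave function -/

/-- Splitting off the last component of a dependent tuple preserves the measure. -/
theorem exists_measurePreserving_last {n : ℕ} {f : Fin n → Fin (n + 1)}
    (hf : (Fin.last n).succAbove = f) (α : Fin (n + 1) → Type*) [∀ i, MeasureSpace (α i)]
    [∀ i, SigmaFinite (volume : Measure (α i))] :
    ∃ e : (∀ i, α i) ≃ᵐ α (Fin.last n) × ∀ j, α (f j), MeasurePreserving e ∧
      ∀ y, e y = (y (Fin.last n), fun j => y (f j)) := by
  -- The types of the components depend on the index, so the index map is substituted as a whole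
  -- rather than rewritten inside those types.
  subst hf
  exact ⟨MeasurableEquiv.piFinSuccAbove α (Fin.last n),
    volume_preserving_piFinSuccAbove α (Fin.last n), fun y => rfl⟩

theorem exists_measurePreserving_levels (n : ℕ) :
    ∃ e : Levels (n + 1) ≃ᵐ (Fin n → ℝ) × Levels n, MeasurePreserving e volume volume ∧
      ∀ y, e y = (y (Fin.last n), fun j : Fin n => y j.castSucc) :=
  exists_measurePreserving_last (f := Fin.castSucc) (funext fun j => Fin.succAbove_last_apply j)
    (fun k : Fin (n + 1) => Fin (k : ℕ) → ℝ)

/-- The parameter b is kept free because the next operator dictates it: the outer raising operator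
needs the imaginary part of its own parameter, which is not among the `l k`. -/
theorem waveBound_waveIntegrand {ω₁ ω₂ g : ℂ} (h₁ : 0 < ω₁.re) (h₂ : 0 < ω₂.re)
    (hg₀ : 0 < g.re) (hg₁ : g.re < ω₁.re + ω₂.re) (hν : 0 < nu ω₁ ω₂ g) {δ η : ℝ} (hδ : 0 ≤ δ)
    (hη : 0 < η) (n : ℕ) :
    ∀ (l : Fin n → ℂ) (b : ℝ), (∀ k, |b - (l k).im| ≤ δ) → (∀ k j, |(l k).im - (l j).im| ≤ δ) →
      Real.pi * δ * (n * (n + 1)) + n * η ≤ 2 * (Real.pi * nu ω₁ ω₂ g) →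
      WaveBound (Real.pi * nu ω₁ ω₂ g) b (Real.pi * δ * (n * (n + 1)) + n * η)
        (waveIntegrand ω₁ ω₂ g n l) ∧
      ∀ x, waveFunction ω₁ ω₂ g n l x = ∫ y, waveIntegrand ω₁ ω₂ g n l x y := by
  induction n with
  | zero =>
    intro l b _ _ _
    have h : (volume : Measure (Levels 0)) = Measure.dirac isEmptyElim :=
      Measure.volume_pi_eq_dirac _
    refine ⟨⟨measurable_const, 1, zero_le_one, fun x => ?_⟩, fun x => ?_⟩
    · have hx : x = 0 := Subsingleton.elim _ _
      rw [h, lintegral_dirac]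
      simp [waveIntegrand, waveExponent, pairDist, hx]
    · rw [h, integral_dirac]
      simp [waveIntegrand, waveFunction]
  | succ n ih =>
    intro l b hb hl hle
    have hpδ : 0 ≤ Real.pi * δ := mul_nonneg Real.pi_pos.le hδ
    have hn : (0 : ℝ) ≤ n := n.cast_nonneg
    push_cast at hle
    have hle' : Real.pi * δ * (n * (n + 1)) + n * η + η ≤ 2 * (Real.pi * nu ω₁ ω₂ g) := by
      nlinarith [mul_nonneg hpδ hn]
    obtain ⟨hW, hV⟩ := ih (fun k => l k.castSucc) (l (Fin.last n)).im
      (fun k => hl _ _) (fun k j => hl _ _) (by linarith)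
    -- Passing from the last spectral parameter to b costs 2πδ(n+1), and n(n+1) + 2(n+1) =
    -- (n+1)(n+2).
    have hW' := (hW.raising h₁ h₂ hg₀ hg₁ hν (by positivity) hη hle').mono (b' := b)
      (κ' := Real.pi * δ * ((n + 1 : ℕ) * ((n + 1 : ℕ) + 1)) + (n + 1 : ℕ) * η) (by
        have := mul_le_mul_of_nonneg_left (hb (Fin.last n))
          (show 0 ≤ 2 * Real.pi * ((n : ℝ) + 1) by positivity)
        push_cast
        linarith)
    obtain ⟨e, he, hey⟩ := exists_measurePreserving_levels n
    have hG : ∀ x y, waveIntegrand ω₁ ω₂ g (n + 1) l x y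
        = (fun q : (Fin n → ℝ) × Levels n => dConst ω₁ ω₂ g n
          * kernel ω₁ ω₂ g (l (Fin.last n)) x q.1
          * waveIntegrand ω₁ ω₂ g n (fun k => l k.castSucc) q.1 q.2) (e y) := by
      intro x y
      rw [hey]
      rfl
    constructor
    · obtain ⟨hm, C, hC0, hC⟩ := hW'
      refine ⟨?_, C, hC0, fun x => ?_⟩
      · have := hm.comp (f := fun r : (Fin (n + 1) → ℝ) × Levels (n + 1) => (r.1, e r.2))
          (measurable_fst.prodMk (e.measurable.comp measurable_snd))
        convert this using 1
        ext r
        exact hG r.1 r.2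
      · simp only [hG]
        rw [he.lintegral_comp_emb e.measurableEmbedding (fun q => ‖dConst ω₁ ω₂ g n
          * kernel ω₁ ω₂ g (l (Fin.last n)) x q.1
          * waveIntegrand ω₁ ω₂ g n (fun k => l k.castSucc) q.1 q.2‖ₑ)]
        exact hC x
    · intro x
      simp only [hG]
      rw [he.integral_comp e.measurableEmbedding (fun q => dConst ω₁ ω₂ g n
          * kernel ω₁ ω₂ g (l (Fin.last n)) x q.1
          * waveIntegrand ω₁ ω₂ g n (fun k => l k.castSucc) q.1 q.2)]
      exact integral_kernel_mul _ hV (hW'.integrable x)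

/-! ### The budget of exponents and the conclusion -/

theorem succ_mul_succ_succ_le_factorial (n : ℕ) : (n + 1) * (n + 2) ≤ 8 * n.factorial := by
  induction n with
  | zero => decide
  | succ n ih =>
    rw [Nat.factorial_succ]
    rcases Nat.lt_or_ge n 2 with h | h
    · interval_cases n <;> decide
    · nlinarith

end Ruijsenaars

/-- The number of variables is `n + 1`, so that every number of variables at least `1` occurs. -/
theorem proposition1 (ω₁ ω₂ g : ℂ)
    (hω₁ : 0 < ω₁.re) (hω₂ : 0 < ω₂.re)
    (hg₀ : 0 < g.re) (hg₁ : g.re < ω₁.re + ω₂.re)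
    (hν : 0 < Ruijsenaars.nu ω₁ ω₂ g)
    (n : ℕ) (ε : ℝ) (hε₀ : 0 ≤ ε) (hε₁ : ε < 1)
    (lam : ℂ) (l : Fin (n + 1) → ℂ)
    (hlam : |(lam - l (Fin.last n)).im| < Ruijsenaars.nu ω₁ ω₂ g / 2 * (1 - ε))
    (hl : ∀ k j : Fin (n + 1), |(l k - l j).im|
      < Ruijsenaars.nu ω₁ ω₂ g / (4 * (n.factorial : ℝ) * Real.exp 1) * ε)
    (x : Fin (n + 1) → ℝ) :
    (MeasureTheory.Integrable
        (Ruijsenaars.baxterWaveIntegrand ω₁ ω₂ g lam (n + 1) l x) MeasureTheory.volume ∧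
      Ruijsenaars.baxterQ ω₁ ω₂ g lam (Ruijsenaars.waveFunction ω₁ ω₂ g (n + 1) l) x
        = ∫ p, Ruijsenaars.baxterWaveIntegrand ω₁ ω₂ g lam (n + 1) l x p) ∧
    (MeasureTheory.Integrable
        (Ruijsenaars.raisingBaxterWaveIntegrand ω₁ ω₂ g lam n l x) MeasureTheory.volume ∧
      Ruijsenaars.raising ω₁ ω₂ g (l (Fin.last n))
          (Ruijsenaars.baxterQ ω₁ ω₂ g lam
            (Ruijsenaars.waveFunction ω₁ ω₂ g n (fun k => l k.castSucc))) x
        = ∫ p, Ruijsenaars.raisingBaxterWaveIntegrand ω₁ ω₂ g lam n l x p) ∧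
    (MeasureTheory.Integrable
        (Ruijsenaars.waveIntegrand ω₁ ω₂ g (n + 1) l x) MeasureTheory.volume ∧
      Ruijsenaars.waveFunction ω₁ ω₂ g (n + 1) l x
        = ∫ y, Ruijsenaars.waveIntegrand ω₁ ω₂ g (n + 1) l x y) := by
  open Ruijsenaars in
  set ν := nu ω₁ ω₂ g with hνdef
  set δ := ν / (4 * (n.factorial : ℝ) * Real.exp 1) * ε with hδdef
  have hf : (0 : ℝ) < n.factorial := by exact_mod_cast n.factorial_pos
  have hn : (0 : ℝ) ≤ n := n.cast_nonneg
  have hπ := Real.pi_pos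
  -- The case k = j of the strict hypothesis already forces δ > 0, hence ε > 0: for ε = 0 the
  -- statement is vacuous.
  have hδ : 0 < δ := (abs_nonneg _).trans_lt (hl 0 0)
  have hε : 0 < ε := by
    rcases hε₀.eq_or_lt with h | h
    · rw [hδdef, ← h, mul_zero] at hδ
      exact absurd hδ (lt_irrefl _)
    · exact h
  -- The total cost of the parameter changes fits into the share νε because 8/(4e) = 2/e < 1.
  have hgap : δ * ((n + 1) * (n + 2)) < ν * ε := by
    have hfac : ((n : ℝ) + 1) * (n + 2) ≤ 8 * n.factorial := by
      exact_mod_cast succ_mul_succ_succ_le_factorial n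
    have he : (2 : ℝ) < Real.exp 1 := by linarith [Real.exp_one_gt_d9]
    calc δ * ((n + 1) * (n + 2)) ≤ δ * (8 * n.factorial) := by gcongr
      _ = ν * ε * (2 / Real.exp 1) := by
        rw [hδdef]
        field_simp
        ring
      _ < ν * ε * 1 := by
        gcongr
        rwa [div_lt_one (Real.exp_pos 1)]
      _ = ν * ε := mul_one _
  -- The slack is divided into n + 2 equal parts, one for each operator in I and in J, counting the
  -- formal Λ₁. The remaining share πν(1 - ε) is left for the mismatch between `lam` and the last
  -- parameter.
  obtain ⟨η, hη, hηle⟩ : ∃ η : ℝ, 0 < η ∧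
      Real.pi * δ * ((n + 1) * (n + 2)) + (n + 2) * η = Real.pi * ν * ε := by
    refine ⟨Real.pi * (ν * ε - δ * ((n + 1) * (n + 2))) / (n + 2), ?_, ?_⟩
    · have := sub_pos.2 hgap
      positivity
    · field_simp
      ring
  have hpε : Real.pi * ν * ε ≤ Real.pi * ν := mul_le_of_le_one_right (by positivity) hε₁.le
  have hpν : 0 < Real.pi * ν := by positivity
  have hlim : ∀ k j, |(l k).im - (l j).im| ≤ δ := fun k j => by
    rw [← Complex.sub_im]
    exact (hl k j).le
  have hlam' : 2 * Real.pi * |lam.im - (l (Fin.last n)).im| + Real.pi * ν * ε ≤ Real.pi * ν := by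
    rw [Complex.sub_im] at hlam
    have := mul_le_mul_of_nonneg_left hlam.le (show 0 ≤ 2 * Real.pi by positivity)
    linarith
  have hδn : 0 ≤ Real.pi * δ * (n + 1) := by positivity
  have hδn' : 0 ≤ Real.pi * δ * (n * (n + 1)) := by positivity
  have hnη : 0 ≤ n * η := by positivity
  obtain ⟨hW, hV⟩ := waveBound_waveIntegrand hω₁ hω₂ hg₀ hg₁ hν hδ.le hη (n + 1) l
    (l (Fin.last n)).im (fun k => hlim _ _) hlim (by push_cast; linarith)
  obtain ⟨hW', hV'⟩ := waveBound_waveIntegrand hω₁ hω₂ hg₀ hg₁ hν hδ.le hη n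
    (fun k => l k.castSucc) (l (Fin.last n)).im (fun k => hlim _ _) (fun k j => hlim _ _)
    (by linarith)
  have hQ := hW.baxter hω₁ hω₂ hg₀ hg₁ (l := lam) (by positivity) hη (by push_cast; linarith)
  have hQ' := hW'.baxter hω₁ hω₂ hg₀ hg₁ (l := lam) (by positivity) hη (by linarith)
  have hR := hQ'.raising hω₁ hω₂ hg₀ hg₁ hν (l := l (Fin.last n)) (by positivity) hη (by linarith)
  refine ⟨⟨hQ.integrable x, integral_kernel_mul _ hV (hQ.integrable x)⟩,
    ⟨hR.integrable x, integral_kernel_mul _ (fun y => ?_) (hR.integrable x)⟩, hW.integrable x, hV x⟩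
  exact integral_kernel_mul _ hV' (hQ'.integrable y)
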